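/- Let $k$ be a number field with ring of integers $O_k$, and let $\Omega_k$ be the set of all places of $k$, archimedean and non-archimedean. For $v\in\Omega_k$ let $k_v$ be the completion of $k$ at $v$, and for non-archimedean $v$ let $O_v\subset k_v$ be its ring of integers. For a finite set $S\subseteq\Omega_k$ and a scheme $X$ of finite type over $k$, let $X(\mathbf A_k^S)$ be the space of adelic points of $X$ without $S$-components, i.e. the restricted product of the topological spaces $X(k_v)$, $v\in\Omega_k\setminus S$, with respect to the subsets $\mathcal X(O_v)$ for non-archimedean $v$ (no condition is imposed at archimedean $v$), where $\mathcal X$ is any model of $X$ of finite type over $O_k$; it does not depend on the choice of $\mathcal X$. We say that $X$ satisfies strong approximation off $S$ if $X(k)$, embedded diagonally, is dense in $X(\mathbf A_k^S)$. Let $S$ be a finite nonempty subset of $\Omega_k$. (1) Let $n\ge 0$ and let $U\subseteq\mathbb A^n_k$ be an open subscheme with $\operatorname{codim}(\mathbb A^n_k\setminus U,\mathbb A^n_k)\ge 2$ (where $\operatorname{codim}(\emptyset,\mathbb A^n_k)=\infty$). Then $U$ satisfies strong approximation off $S$. (2) Let $d\geq 1$, let $k_1,\dots,k_d$ be finite field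 extensions of $k$, and put $K=\prod_{i=1}^d k_i$. Let $X$ be the standard toric variety with respect to $K/k$: writing $T=\operatorname{Res}_{K/k}(\mathbb G_m)$, acting on $\operatorname{Res}_{K/k}(\mathbb A^1)$ by multiplication, $X$ is the unique $T$-stable open subscheme of $\operatorname{Res}_{K/k}(\mathbb A^1)$ containing $T$ such that every $T(\bar k)$-orbit in $X(\bar k)$ has dimension $\dim T$ or $\dim T-1$ and such that $\operatorname{codim}(\operatorname{Res}_{K/k}(\mathbb A^1)\setminus X,\operatorname{Res}_{K/k}(\mathbb A^1))\ge 2$. Then $X$ satisfies strong approximation off $S$. -/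

import Mathlib

open CategoryTheory AlgebraicGeometry NumberField IsDedekindDomain
open scoped TensorProduct RestrictedProduct

universe u

noncomputable section

namespace StrongApprox

/-! ### Points of schemes over fields and adelic points -/

section Points

variable {k : Type u} [Field k]

/-- `X(F)`: the `F`-valued points of a `k`-scheme `X`, for a `k`-algebra `F`. -/
def Points (X : Over (Spec (.of k))) (F : Type u) [CommRing F] [Algebra k F] : Type u :=
  {x : Spec (.of F) ⟶ X.left // x ≫ X.hom = Spec.map (CommRingCat.ofHom (algebraMap k F))}

/-- The map `X(k) → X(F)`. -/
def Points.baseChange {X : Over (Spec (.of k))} (x : Points X k)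
    (F : Type u) [CommRing F] [Algebra k F] : Points X F :=
  ⟨Spec.map (CommRingCat.ofHom (algebraMap k F)) ≫ x.1, by
    rw [Category.assoc, x.2, ← Spec.map_comp, ← CommRingCat.ofHom_comp]⟩

/-- The `F`-points `x ∈ V(F) = Hom(Γ(X, V), F)`, for an affine open `V ⊆ X`, at which the regular
function `f` on `V` takes a value in `O ⊆ F`. -/
def Points.evalIn {X : Over (Spec (.of k))} {F : Type u} [CommRing F] [Algebra k F]
    {V : X.left.Opens} (hV : IsAffineOpen V) (f : Γ(X.left, V)) (O : Set F) : Set (Points X F) :=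
  {x | ∃ φ : Γ(X.left, V) ⟶ CommRingCat.of F, Spec.map φ ≫ hV.fromSpec = x.1 ∧ φ.hom f ∈ O}

/-- The `F`-topology on `X(F)`, for a topological field `F`: the topology glued from the sets
`V(F) = Hom(Γ(X, V), F)`, `V ⊆ X` affine open, where `V(F)` is open and carries the coarsest
topology for which all evaluations `V(F) → F` at regular functions on `V` are continuous. -/
instance Points.topology (X : Over (Spec (.of k))) (F : Type u) [Field F] [Algebra k F]
    [TopologicalSpace F] : TopologicalSpace (Points X F) :=
  TopologicalSpace.generateFrom
    {W | ∃ (V : X.left.Opens) (hV : IsAffineOpen V) (f : Γ(X.left, V)) (O : Set F),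
      IsOpen O ∧ W = Points.evalIn hV f O}

end Points

section Adelic

variable {k : Type u} [Field k] [NumberField k]

/-- The set `Ω_k` of all places of the number field `k`, archimedean and non-archimedean. -/
abbrev Place (k : Type u) [Field k] [NumberField k] : Type u :=
  InfinitePlace k ⊕ HeightOneSpectrum (𝓞 k)

/-- A model of finite type over `O_k` of a `k`-scheme `X`: an `O_k`-scheme of finite type together
with an identification of its generic fibre with `X`. -/
structure IntegralModel (X : Over (Spec (.of k))) where
  /-- the total space of the model -/
  scheme : Scheme.{u}
  /-- the structure morphism -/
  toBase : scheme ⟶ Spec (.of (𝓞 k))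
  /-- the inclusion of the generic fibre -/
  generic : X.left ⟶ scheme
  locallyOfFiniteType : LocallyOfFiniteType toBase
  quasiCompact : QuasiCompact toBase
  isPullback : IsPullback generic X.hom toBase
    (Spec.map (CommRingCat.ofHom (algebraMap (𝓞 k) k)))

/-- The set of those points of `X(k_v)` that come from `𝒳(O_v)`, for a finite place `v`. -/
def IntegralModel.integralPoints {X : Over (Spec (.of k))} (M : IntegralModel X)
    (v : HeightOneSpectrum (𝓞 k)) : Set (Points X (v.adicCompletion k)) :=
  {x | ∃ y : Spec (.of (v.adicCompletionIntegers k)) ⟶ M.scheme,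
    y ≫ M.toBase =
      Spec.map (CommRingCat.ofHom (algebraMap (𝓞 k) (v.adicCompletionIntegers k))) ∧
    Spec.map (CommRingCat.ofHom
      (algebraMap (v.adicCompletionIntegers k) (v.adicCompletion k))) ≫ y = x.1 ≫ M.generic}

/-- `X(𝐀_k^S)`, the space of adelic points of `X` without components at the places in `S`: the
restricted product of the `X(k_v)`, `v ∉ S`, with respect to the `𝒳(O_v)` (where there is no
condition at archimedean places), with the restricted product topology. For `X` of finite type
over `k` it does not depend on the choice of the model. -/
abbrev AdelicPoints {X : Over (Spec (.of k))} (M : IntegralModel X) (S : Finset (Place k)) :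
    Type u :=
  (∀ v : {v : InfinitePlace k // Sum.inl v ∉ S}, Points X v.1.Completion) ×
  Πʳ v : {v : HeightOneSpectrum (𝓞 k) // Sum.inr v ∉ S},
    [Points X (v.1.adicCompletion k), M.integralPoints v.1]

/-- The image of `X(k)` under the diagonal embedding in `X(𝐀_k^S)`. -/
def rationalAdelicPoints {X : Over (Spec (.of k))} (M : IntegralModel X) (S : Finset (Place k)) :
    Set (AdelicPoints M S) :=
  {a | ∃ x : Points X k,
    (∀ v : {v : InfinitePlace k // Sum.inl v ∉ S}, a.1 v = x.baseChange v.1.Completion) ∧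
    (∀ v : {v : HeightOneSpectrum (𝓞 k) // Sum.inr v ∉ S},
      a.2 v = x.baseChange (v.1.adicCompletion k))}

/-- `X` satisfies strong approximation off `S`: `X(k)` is dense in `X(𝐀_k^S)`. The latter is formed
with a model over `O_k`; it is part of the definition that models exist (which is automatic for `X`
of finite type), and density is required for every one of them. -/
def StrongApproximationOff (X : Over (Spec (.of k))) (S : Finset (Place k)) : Prop :=
  Nonempty (IntegralModel X) ∧ ∀ M : IntegralModel X, Dense (rationalAdelicPoints M S)

end Adelic

/-! ### Codimension -/

/-- The codimension of a subset `Z` (in practice closed) of a topological space `T`: the infimum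
over all irreducible closed `Y ⊆ Z` of the supremum of the lengths of chains `Y ⊊ Y₁ ⊊ ⋯ ⊊ Y_r`
of irreducible closed subsets of `T`. In particular `codim ∅ = ∞`. -/
def codim {T : Type u} [TopologicalSpace T] (Z : Set T) : ℕ∞ :=
  ⨅ (Y : TopologicalSpace.IrreducibleCloseds T) (_ : (Y : Set T) ⊆ Z), Order.coheight Y

/-- An open subscheme of affine `n`-space over `k`, as a `k`-scheme. -/
abbrev openInAffineSpace {k : Type u} [Field k] {n : ℕ}
    (U : (AffineSpace (ULift.{u} (Fin n)) (Spec (.of k))).Opens) : Over (Spec (.of k)) :=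
  Over.mk (U.ι ≫ (AffineSpace (ULift.{u} (Fin n)) (Spec (.of k)) ↘ Spec (.of k)))

/-! ### Weil restriction of the affine line and of the multiplicative group -/

section Weil

variable (k : Type u) [Field k] (K : Type u) [CommRing K] [Algebra k K]

/-- The coordinate ring `Sym_k(K^∨)` of `Res_{K/k}(𝔸¹)`. -/
abbrev ResCoord : Type u := SymmetricAlgebra k (Module.Dual k K)

/-- `Res_{K/k}(𝔸¹)`, the scheme that represents the functor `A ↦ A ⊗ K` on `k`-algebras. -/
abbrev ResA1 : Scheme.{u} := Spec (.of (ResCoord k K))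

variable {k K}

/-- The `A`-point of `Res_{K/k}(𝔸¹)` given by `a ∈ A ⊗ K`: the homomorphism `Sym_k(K^∨) → A` that
extends `ℓ ↦ (id ⊗ ℓ)(a)`. -/
def resPoint {A : Type u} [CommRing A] [Algebra k A] (a : A ⊗[k] K) : ResCoord k K →ₐ[k] A :=
  SymmetricAlgebra.lift
    { toFun := fun l => TensorProduct.rid k A (LinearMap.lTensor A l a)
      map_add' := fun l m => by rw [LinearMap.lTensor_add]; simp
      map_smul' := fun c l => by rw [LinearMap.lTensor_smul]; simp }

lemma resPoint_ι {A : Type u} [CommRing A] [Algebra k A] (a : A ⊗[k] K) (l : Module.Dual k K) :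
    resPoint a (SymmetricAlgebra.ι k _ l) = TensorProduct.rid k A (LinearMap.lTensor A l a) :=
  SymmetricAlgebra.lift_ι_apply _ _

variable (k K) in
/-- The universal element `∑ bᵢ^∨ ⊗ bᵢ` of `Sym_k(K^∨) ⊗ K`. -/
def resUniversal [Module.Finite k K] : ResCoord k K ⊗[k] K :=
  ∑ i, SymmetricAlgebra.ι k (Module.Dual k K) ((Module.finBasis k K).coord i) ⊗ₜ[k]
    Module.finBasis k K i

variable (k K) in
/-- `Res_{K/k}(𝔾_m)`, as an open subscheme of `Res_{K/k}(𝔸¹)`: the locus where the norm of the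
universal element is invertible. -/
def ResGm [Module.Finite k K] : (ResA1 k K).Opens :=
  PrimeSpectrum.basicOpen (Algebra.norm (ResCoord k K) (resUniversal k K))

/-- `X(A) ⊆ A ⊗ K` for an open subscheme `X` of `Res_{K/k}(𝔸¹)` and a `k`-algebra `A`: the points
`Spec A → Res_{K/k}(𝔸¹)` that factor through `X`. -/
def openPoints (X : (ResA1 k K).Opens) (A : Type u) [CommRing A] [Algebra k A] :
    Set (A ⊗[k] K) :=
  {a | ∀ p : PrimeSpectrum A, PrimeSpectrum.comap (resPoint a).toRingHom p ∈ X}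

section Facts

variable [Module.Finite k K] {A : Type u} [CommRing A] [Algebra k A]

lemma map_resPoint_resUniversal (a : A ⊗[k] K) :
    Algebra.TensorProduct.map (resPoint a) (AlgHom.id k K) (resUniversal k K) = a := by
  simp only [resUniversal, map_sum, Algebra.TensorProduct.map_tmul, resPoint,
    SymmetricAlgebra.lift_ι_apply, LinearMap.coe_mk, AddHom.coe_mk, AlgHom.id_apply]
  induction a with
  | zero => simp
  | add x y hx hy => simp only [map_add, TensorProduct.add_tmul, Finset.sum_add_distrib, hx, hy]
  | tmul a x =>
    simp only [LinearMap.lTensor_tmul, TensorProduct.rid_tmul, TensorProduct.smul_tmul,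
      ← TensorProduct.tmul_sum]
    congr 1
    exact (Module.finBasis k K).sum_repr x

lemma resPoint_bijective :
    Function.Bijective (resPoint : A ⊗[k] K → (ResCoord k K →ₐ[k] A)) := by
  refine ⟨fun a b h => ?_, fun φ =>
    ⟨Algebra.TensorProduct.map φ (AlgHom.id k K) (resUniversal k K), ?_⟩⟩
  · rw [← map_resPoint_resUniversal a, h, map_resPoint_resUniversal]
  · apply SymmetricAlgebra.algHom_ext
    ext l
    change resPoint _ (SymmetricAlgebra.ι k _ l) = φ (SymmetricAlgebra.ι k _ l)
    rw [resPoint_ι]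
    simp only [resUniversal, map_sum, Algebra.TensorProduct.map_tmul, AlgHom.id_apply,
      LinearMap.lTensor_tmul, TensorProduct.rid_tmul]
    conv_rhs => rw [← (Module.finBasis k K).sum_dual_apply_smul_coord l]
    simp only [map_sum, map_smul]

lemma map_norm_tensor (φ : ResCoord k K →ₐ[k] A) (z : ResCoord k K ⊗[k] K) :
    φ (Algebra.norm (ResCoord k K) z) =
      Algebra.norm A (Algebra.TensorProduct.map φ (AlgHom.id k K) z) := by
  have key : ∀ (w : ResCoord k K ⊗[k] K) i,
      φ ((Algebra.TensorProduct.basis (ResCoord k K) (Module.finBasis k K)).repr w i) =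
        (Algebra.TensorProduct.basis A (Module.finBasis k K)).repr
          (Algebra.TensorProduct.map φ (AlgHom.id k K) w) i := by
    intro w i
    induction w with
    | zero => simp
    | add x y hx hy => simp [hx, hy]
    | tmul a x => simp [Algebra.TensorProduct.basis_repr_tmul]
  rw [Algebra.norm_eq_matrix_det (Algebra.TensorProduct.basis _ (Module.finBasis k K)),
    Algebra.norm_eq_matrix_det (Algebra.TensorProduct.basis _ (Module.finBasis k K)),
    AlgHom.map_det]
  congr 1
  ext i j
  simp only [AlgHom.mapMatrix_apply, Matrix.map_apply, Algebra.leftMulMatrix_eq_repr_mul]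
  rw [key, map_mul]
  simp

/-- `Res_{K/k}(𝔾_m)(A) = (A ⊗ K)ˣ`. -/
lemma mem_openPoints_resGm (a : A ⊗[k] K) : a ∈ openPoints (ResGm k K) A ↔ IsUnit a := by
  have h1 : a ∈ openPoints (ResGm k K) A ↔
      IsUnit (resPoint a (Algebra.norm (ResCoord k K) (resUniversal k K))) := by
    constructor
    · intro h
      by_contra hu
      obtain ⟨m, hm, hmem⟩ := exists_max_ideal_of_mem_nonunits hu
      exact h ⟨m, hm.isPrime⟩ hmem
    · intro hu p hp
      exact p.isPrime.ne_top (Ideal.eq_top_of_isUnit_mem _ hp hu)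
  rw [h1, map_norm_tensor, map_resPoint_resUniversal, Algebra.norm_apply,
    ← LinearMap.isUnit_iff_isUnit_det, Algebra.lmul_isUnit_iff]

end Facts

end Weil

/-! ### Standard toric varieties -/

section Toric

variable {k : Type u} [Field k] {K : Type u} [CommRing K] [Algebra k K]

/-- The closed point of `Res_{K/k}(𝔸¹) ×_k k̄` given by a geometric point `x ∈ k̄ ⊗ K`, that is, the
kernel of the `k̄`-algebra homomorphism `k̄ ⊗ Sym_k(K^∨) → k̄` that corresponds to `x`. -/
def geometricPoint (x : AlgebraicClosure k ⊗[k] K) :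
    PrimeSpectrum (AlgebraicClosure k ⊗[k] ResCoord k K) :=
  PrimeSpectrum.comap
    (Algebra.TensorProduct.lift (AlgHom.id (AlgebraicClosure k) (AlgebraicClosure k)) (resPoint x)
      fun _ _ => Commute.all _ _).toRingHom ⊥

/-- The dimension of a set of geometric points of `Res_{K/k}(𝔸¹)` in the Zariski topology. -/
def geometricDim (Z : Set (AlgebraicClosure k ⊗[k] K)) : WithBot ℕ∞ :=
  topologicalKrullDim (geometricPoint '' Z)

/-- The open subscheme `X` of `Res_{K/k}(𝔸¹)` is the standard toric variety with respect to `K/k`: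
it is an open toric subvariety of `Res_{K/k}(𝔾_m) ↪ Res_{K/k}(𝔸¹)`, that is, it contains the torus
`T = Res_{K/k}(𝔾_m)` and is stable under its action (on `A`-points, the action of `(A ⊗ K)ˣ` on
`A ⊗ K` by multiplication); it is of pure divisorial type, that is, each `T(k̄)`-orbit in `X(k̄)` has
dimension `dim T` or `dim T - 1`; and its complement has codimension at least two. -/
structure IsStandardToricVariety [Module.Finite k K] (X : (ResA1 k K).Opens) : Prop where
  torus_le : ResGm k K ≤ X
  stable : ∀ (A : Type u) [CommRing A] [Algebra k A] (g : (A ⊗[k] K)ˣ) (x : A ⊗[k] K),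
    x ∈ openPoints X A → (g : A ⊗[k] K) * x ∈ openPoints X A
  pure_divisorial : ∀ x ∈ openPoints X (AlgebraicClosure k),
    geometricDim (MulAction.orbit (AlgebraicClosure k ⊗[k] K)ˣ x) =
        topologicalKrullDim (ResGm k K) ∨
      geometricDim (MulAction.orbit (AlgebraicClosure k ⊗[k] K)ˣ x) + 1 =
        topologicalKrullDim (ResGm k K)
  two_le_codim : 2 ≤ codim (X : Set (ResA1 k K))ᶜ

/-- An open subscheme of `Res_{K/k}(𝔸¹)`, as a `k`-scheme. -/
abbrev openInResA1 (X : (ResA1 k K).Opens) : Over (Spec (.of k)) :=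
  Over.mk (X.ι ≫ Spec.map (CommRingCat.ofHom (algebraMap k (ResCoord k K))))

end Toric

end StrongApprox

end

/-! Part (2) is a case of part (1): `ResA1 k K` is the spectrum of a symmetric algebra on a
finite-dimensional space, hence an affine space over `k`, and the complement of a standard toric
variety has codimension at least two. So let `U` be open in affine space with such a complement `Z`,
and let `I` be the vanishing ideal of `Z`.

Elimination. In positive dimension, a Nagata change of coordinates makes some element `f` of `I`
monic in the first variable. As every prime containing `I` has height at least two, `I` also
contains a nonzero `r` free of the first variable (`exists_monic_and_eliminant`). Both basic open
sets `f ≠ 0` and `r ≠ 0` lie in `U`.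

Fibration. Strong approximation for affine space gives the last coordinates `a`, with `r(a) ≠ 0`.
Then `r(a)` is divisible by only finitely many further places `v`, and at these the first coordinate
`t` is chosen so that `f(t, a)` is not divisible by `v`. This is possible because `f(·, a)` is monic
of some degree `d`: if `v` does not divide `d!`, it cannot divide all the values at `0, …, d`, since
their alternating binomial sum is `d!`. Hence at each remaining place one of `f` and `r` is not
divisible by `v` (`approximablePair_of_monic`). The input for single coordinates,
`exists_mem_of_isOpen`, comes from the Chinese remainder theorem, cocompactness of the integers at
the archimedean places and Minkowski's theorem.

Adelic points. The topology of `X(F)` is coarser than that of the coordinates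
(`exists_isOpen_coord`), and the integral points of a model form an open set. For almost all `v`, a
point with integral coordinates at which `f` or `r` is not divisible by `v` is integral on the given
model (`IntegralModel.exists_finset_mem_integralPoints`). The rational points found above thus
approximate a given adelic point. -/

noncomputable section

namespace StrongApprox

/-! ### Polynomials that are monic in the first variable -/

section Nagata

open MvPolynomial

variable {k : Type*} [Field k] {n : ℕ}

/-- The endomorphism `X₀ ↦ X₀`, `Xᵢ ↦ Xᵢ + c X₀ ^ (u ^ i)` of a polynomial ring. -/
def nagataHom (u : ℕ) (c : k) :
    MvPolynomial (Fin (n + 1)) k →ₐ[k] MvPolynomial (Fin (n + 1)) k :=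
  aeval fun i ↦ if i = 0 then X 0 else X i + c • X 0 ^ (u ^ i.1)

lemma nagataHom_X_zero (u : ℕ) (c : k) : nagataHom (n := n) u c (X 0) = X 0 := by
  simp [nagataHom]

lemma nagataHom_X_succ (u : ℕ) (c : k) (i : Fin n) :
    nagataHom u c (X i.succ) = X i.succ + c • X 0 ^ (u ^ (i.1 + 1)) := by
  simp [nagataHom]

lemma nagataHom_comp_neg (u : ℕ) (c : k) :
    (nagataHom u c).comp (nagataHom u (-c)) = AlgHom.id k (MvPolynomial (Fin (n + 1)) k) := by
  refine MvPolynomial.algHom_ext fun i ↦ ?_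
  cases i using Fin.cases with
  | zero => simp [nagataHom_X_zero]
  | succ i => simp [nagataHom_X_zero, nagataHom_X_succ]

/-- Nagata's automorphism `X₀ ↦ X₀`, `Xᵢ ↦ Xᵢ + X₀ ^ (u ^ i)` of a polynomial ring. -/
def nagataEquiv (k : Type*) [Field k] (n u : ℕ) :
    MvPolynomial (Fin (n + 1)) k ≃ₐ[k] MvPolynomial (Fin (n + 1)) k :=
  AlgEquiv.ofAlgHom (nagataHom u (1 : k)) (nagataHom u (-1 : k))
    (nagataHom_comp_neg u (1 : k)) (by
      have h := nagataHom_comp_neg (n := n) u (-1 : k)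
      rwa [neg_neg] at h)

/-- Besides the constant, all factors on the right are monic in the first variable, so leading terms
can be read off monomial by monomial. -/
lemma finSuccEquiv_nagataEquiv_monomial (u : ℕ) (v : Fin (n + 1) →₀ ℕ) (a : k) :
    MvPolynomial.finSuccEquiv k n (nagataEquiv k n u (monomial v a)) =
      Polynomial.C (C a) * (Polynomial.X ^ v 0 * ∏ i : Fin n,
        (Polynomial.X ^ (u ^ (i.1 + 1)) + Polynomial.C (X i)) ^ v i.succ) := by
  rw [monomial_eq, Finsupp.prod_pow v fun a ↦ X a, Fin.prod_univ_succ]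
  have h0 : nagataEquiv k n u (X 0) = X 0 := nagataHom_X_zero u 1
  have h1 (i : Fin n) : nagataEquiv k n u (X i.succ) = X i.succ + X 0 ^ (u ^ (i.1 + 1)) := by
    simpa using! nagataHom_X_succ u (1 : k) i
  have h2 : nagataEquiv k n u (C a) = C a := (nagataEquiv k n u).commutes a
  simp only [map_mul, map_prod, map_pow, map_add, h0, h1, h2, finSuccEquiv_X_zero,
    finSuccEquiv_X_succ, add_comm]
  congr 1
  exact (MvPolynomial.finSuccEquiv k n).commutes a

lemma monic_prod_nagata (u : ℕ) (v : Fin (n + 1) →₀ ℕ) (hu : u ≠ 0) :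
    (Polynomial.X ^ v 0 * ∏ i : Fin n, (Polynomial.X ^ (u ^ (i.1 + 1)) +
      Polynomial.C (X i : MvPolynomial (Fin n) k)) ^ v i.succ).Monic :=
  (Polynomial.monic_X_pow _).mul <| Polynomial.monic_prod_of_monic _ _ fun _ _ ↦
    (Polynomial.monic_X_pow_add_C _ (pow_ne_zero _ hu)).pow _

lemma natDegree_prod_nagata (u : ℕ) (v : Fin (n + 1) →₀ ℕ) (hu : u ≠ 0) :
    (Polynomial.X ^ v 0 * ∏ i : Fin n, (Polynomial.X ^ (u ^ (i.1 + 1)) +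
      Polynomial.C (X i : MvPolynomial (Fin n) k)) ^ v i.succ).natDegree =
    ∑ i : Fin (n + 1), u ^ i.1 * v i := by
  have hm (i : Fin n) : (Polynomial.X ^ (u ^ (i.1 + 1)) +
      Polynomial.C (X i : MvPolynomial (Fin n) k)).Monic :=
    Polynomial.monic_X_pow_add_C _ (pow_ne_zero _ hu)
  rw [(Polynomial.monic_X_pow _).natDegree_mul
    (Polynomial.monic_prod_of_monic _ _ fun i _ ↦ (hm i).pow _),
    Polynomial.natDegree_prod_of_monic _ _ fun i _ ↦ (hm i).pow _, Fin.sum_univ_succ]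
  simp [(hm _).natDegree_pow, mul_comm]

/-- The exponents are the base-`u` digits of the weighted degree. Distinct monomials therefore
cannot have the same degree after Nagata's substitution, and their leading terms cannot cancel. -/
lemma sum_pow_mul_injective {u : ℕ} (hu : 1 < u) {v w : Fin (n + 1) →₀ ℕ} (hv : ∀ i, v i < u)
    (hw : ∀ i, w i < u)
    (h : ∑ i : Fin (n + 1), u ^ i.1 * v i = ∑ i : Fin (n + 1), u ^ i.1 * w i) : v = w := by
  have hlt {v : Fin (n + 1) →₀ ℕ} (hv : ∀ i, v i < u) : ∀ l ∈ List.ofFn v, l < u := by grind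
  refine Finsupp.ext <| congrFun <| List.ofFn_inj.mp ?_
  apply Nat.ofDigits_inj_of_len_eq hu (by simp) (hlt hv) (hlt hw)
  simpa only [Nat.ofDigits_eq_sum_mapIdx, List.mapIdx_eq_ofFn, List.get_ofFn, List.length_ofFn,
    Fin.val_cast, mul_comm, List.sum_ofFn] using! h

/-- Every nonzero polynomial becomes monic in the first variable, up to a constant, after some
automorphism of the polynomial ring. -/
lemma exists_algEquiv_monic (f : MvPolynomial (Fin (n + 1)) k) (hf : f ≠ 0) :
    ∃ (σ : MvPolynomial (Fin (n + 1)) k ≃ₐ[k] MvPolynomial (Fin (n + 1)) k) (c : k), c ≠ 0 ∧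
      (MvPolynomial.finSuccEquiv k n (σ (c • f))).Monic := by
  -- Larger than every exponent in `f`, and larger than `1`, so that exponents are digits in base
  -- `u`.
  set u := 2 + f.totalDegree
  have hu0 : u ≠ 0 := by simp [u]
  have hlt {v} (hv : v ∈ f.support) (i) : v i < u :=
    ((monomial_le_degreeOf i hv).trans (degreeOf_le_totalDegree f i)).trans_lt (by simp [u])
  let d (v : Fin (n + 1) →₀ ℕ) := ∑ i : Fin (n + 1), u ^ i.1 * v i
  obtain ⟨v, hv, hmax⟩ := Finset.exists_max_image f.support d (support_nonempty.mpr hf)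
  have hc : coeff v f ≠ 0 := mem_support_iff.mp hv
  refine ⟨nagataEquiv k n u, (coeff v f)⁻¹, inv_ne_zero hc, ?_⟩
  let G (w : Fin (n + 1) →₀ ℕ) (a : k) : Polynomial (MvPolynomial (Fin n) k) :=
    MvPolynomial.finSuccEquiv k n (nagataEquiv k n u (monomial w a))
  have hsum (b : k) (hb : b * coeff v f = 1) :
      MvPolynomial.finSuccEquiv k n (nagataEquiv k n u (b • f)) =
        G v 1 + ∑ w ∈ f.support.erase v, G w (b * coeff w f) := by
    conv_lhs => rw [f.as_sum, Finset.smul_sum]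
    simp only [map_sum, smul_monomial, smul_eq_mul]
    rw [← Finset.add_sum_erase _ _ hv, hb]
  have hG1 : (G v 1).Monic := by
    simpa [G, finSuccEquiv_nagataEquiv_monomial] using monic_prod_nagata u v hu0
  have hdeg : (G v 1).natDegree = d v := by
    simpa [G, finSuccEquiv_nagataEquiv_monomial] using natDegree_prod_nagata (k := k) u v hu0
  rw [hsum _ (inv_mul_cancel₀ hc)]
  refine hG1.add_of_left ((Polynomial.degree_sum_le _ _).trans_lt ?_)
  rw [Polynomial.degree_eq_natDegree hG1.ne_zero, hdeg,
    Finset.sup_lt_iff (WithBot.bot_lt_coe _)]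
  intro w hw
  have hwv := Finset.mem_erase.mp hw
  have hlt' : d w < d v := lt_of_le_of_ne (hmax w hwv.2) fun h ↦
    hwv.1 (sum_pow_mul_injective (by simp [u]; omega) (hlt hwv.2) (hlt hv) h)
  refine Polynomial.degree_le_natDegree.trans_lt (Nat.cast_lt.mpr (lt_of_le_of_lt ?_ hlt'))
  simp only [G, finSuccEquiv_nagataEquiv_monomial]
  exact (Polynomial.natDegree_C_mul_le _ _).trans (natDegree_prod_nagata u w hu0).le

end Nagata

/-! ### Elimination for ideals of height at least two -/

section Elimination

/-- An ideal of `A[X]` all of whose minimal primes have height at least two meets `A`. -/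
lemma exists_C_mem_of_height {A : Type*} [CommRing A] [IsDomain A] (I : Ideal (Polynomial A))
    (hI : ∀ Q : Ideal (Polynomial A), Q.IsPrime → I ≤ Q → ∃ P : Ideal (Polynomial A),
      P.IsPrime ∧ P ≠ ⊥ ∧ P < Q) :
    ∃ a : A, a ≠ 0 ∧ Polynomial.C a ∈ I := by
  by_contra! hcon
  -- If `I` contained no nonzero constant, some prime `Q ⊇ I` would contain none either. For a
  -- nonzero prime `P < Q`, the ring `A[X]/P` contains `A` and is algebraic over it, so the nonzero
  -- ideal `Q/P` must meet `A` nontrivially, a contradiction.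
  obtain ⟨Q, hQ, hIQ, hdisj⟩ := Ideal.exists_le_prime_disjoint I
    ((nonZeroDivisors A).map (Polynomial.C : A →+* Polynomial A)) (by
      rw [Set.disjoint_left]
      rintro _ hx ⟨a, ha, rfl⟩
      exact hcon a (nonZeroDivisors.ne_zero ha) hx)
  obtain ⟨P, hP, hP0, hPQ⟩ := hI Q hQ hIQ
  have hQA (a : A) (ha : Polynomial.C a ∈ Q) : a = 0 := by
    by_contra h0
    exact Set.disjoint_left.mp hdisj ha ⟨a, mem_nonZeroDivisors_of_ne_zero h0, rfl⟩
  have hinj : Function.Injective (algebraMap A (Polynomial A ⧸ P)) := by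
    rw [injective_iff_map_eq_zero]
    intro a ha
    exact hQA a (hPQ.le (Ideal.Quotient.eq_zero_iff_mem.mp ha))
  obtain ⟨p, hpP, hp0⟩ := Submodule.exists_mem_ne_zero_of_ne_bot hP0
  have hmk (q : Polynomial A) :
      Polynomial.aeval (Ideal.Quotient.mk P Polynomial.X) q = Ideal.Quotient.mk P q := by
    have := Polynomial.aeval_algHom_apply (Ideal.Quotient.mkₐ A P) Polynomial.X q
    simpa using this
  have hX : IsAlgebraic A (Ideal.Quotient.mk P Polynomial.X) :=
    ⟨p, hp0, by rw [hmk]; exact Ideal.Quotient.eq_zero_iff_mem.mpr hpP⟩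
  have halg (q : Polynomial A) : IsAlgebraic A (Ideal.Quotient.mk P q) := by
    rw [← hmk]
    refine (Algebra.isAlgebraic_adjoin_singleton_iff.mpr hX) _ ?_
    exact Polynomial.aeval_mem_adjoin_singleton A _
  obtain ⟨x, hxQ, hxP⟩ := SetLike.exists_of_lt hPQ
  have hne : Ideal.Quotient.mk P x ≠ 0 := fun h ↦ hxP (Ideal.Quotient.eq_zero_iff_mem.mp h)
  refine Ideal.comap_ne_bot_of_algebraic_mem (R := A) hne
    (I := Q.map (Ideal.Quotient.mk P)) (Ideal.mem_map_of_mem _ hxQ) (halg x) ?_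
  rw [eq_bot_iff]
  intro a ha
  rw [Ideal.mem_comap] at ha
  obtain ⟨q, hq, hqa⟩ := (Ideal.mem_map_iff_of_surjective _ Ideal.Quotient.mk_surjective).mp ha
  refine hQA a ?_
  have : q - Polynomial.C a ∈ P := Ideal.Quotient.eq.mp hqa
  have h2 := Q.sub_mem hq (hPQ.le this)
  simpa using h2

open MvPolynomial in
lemma finSuccEquiv_rename_succ {k : Type*} [Field k] {n : ℕ} (r : MvPolynomial (Fin n) k) :
    MvPolynomial.finSuccEquiv k n (rename Fin.succ r) = Polynomial.C r := by
  induction r using MvPolynomial.induction_on with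
  | C a => rw [rename_C]; exact (MvPolynomial.finSuccEquiv k n).commutes a
  | add p q hp hq => simp only [map_add, hp, hq]
  | mul_X p i hp => simp only [map_mul, hp, rename_X, finSuccEquiv_X_succ]

open MvPolynomial in
-- The change of coordinates is fixed first, by making one element of `I` monic; the height
-- condition is invariant under it, so the eliminant can then be found in the new coordinates.
lemma exists_monic_and_eliminant {k : Type*} [Field k] {n : ℕ}
    (I : Ideal (MvPolynomial (Fin (n + 1)) k))
    (hI : ∀ Q : Ideal (MvPolynomial (Fin (n + 1)) k), Q.IsPrime → I ≤ Q →
      ∃ P : Ideal (MvPolynomial (Fin (n + 1)) k), P.IsPrime ∧ P ≠ ⊥ ∧ P < Q) :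
    ∃ (σ : MvPolynomial (Fin (n + 1)) k ≃ₐ[k] MvPolynomial (Fin (n + 1)) k)
      (f : MvPolynomial (Fin (n + 1)) k) (r : MvPolynomial (Fin n) k),
      (MvPolynomial.finSuccEquiv k n f).Monic ∧ r ≠ 0 ∧ σ.symm f ∈ I ∧ σ.symm (rename Fin.succ r) ∈ I := by
  have hI0 : I ≠ ⊥ := by
    rintro rfl
    obtain ⟨P, -, hP, hlt⟩ := hI ⊥ Ideal.isPrime_bot le_rfl
    exact not_lt_bot hlt
  obtain ⟨g, hgI, hg0⟩ := Submodule.exists_mem_ne_zero_of_ne_bot hI0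
  obtain ⟨σ, c, hc, hmon⟩ := exists_algEquiv_monic g hg0
  let τ : MvPolynomial (Fin (n + 1)) k ≃+* Polynomial (MvPolynomial (Fin n) k) :=
    (σ.trans (MvPolynomial.finSuccEquiv k n)).toRingEquiv
  obtain ⟨r, hr0, hr⟩ := exists_C_mem_of_height (I.comap τ.symm.toRingHom) (by
    intro Q hQ hIQ
    obtain ⟨P, hP, hP0, hPQ⟩ := hI (Q.comap τ.toRingHom) inferInstance (by
      intro x hx
      exact hIQ (by simpa [Ideal.mem_comap] using hx))
    refine ⟨P.comap τ.symm.toRingHom, inferInstance, ?_, ?_, ?_⟩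
    · obtain ⟨p, hpP, hp0⟩ := Submodule.exists_mem_ne_zero_of_ne_bot hP0
      intro h
      have : τ p ∈ P.comap τ.symm.toRingHom := by simpa [Ideal.mem_comap] using hpP
      rw [h, Ideal.mem_bot, map_eq_zero_iff _ τ.injective] at this
      exact hp0 this
    · intro x hx
      have := hPQ.le (show τ.symm x ∈ P from hx)
      rw [Ideal.mem_comap] at this
      exact (τ.apply_symm_apply x) ▸ this
    · intro hle
      refine hPQ.not_ge fun x hx ↦ ?_
      simpa [Ideal.mem_comap] using hle (show τ x ∈ Q from hx))
  refine ⟨σ, σ (c • g), r, hmon, hr0, ?_, ?_⟩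
  · rw [σ.symm_apply_apply]
    exact Submodule.smul_of_tower_mem I c hgI
  · have : τ.symm (Polynomial.C r) = σ.symm (rename Fin.succ r) := by
      rw [RingEquiv.symm_apply_eq]
      change _ = MvPolynomial.finSuccEquiv k n (σ (σ.symm (rename Fin.succ r)))
      rw [σ.apply_symm_apply, finSuccEquiv_rename_succ]
    rw [← this]
    exact hr

end Elimination

/-! ### Strong approximation for the affine line -/

section Line

open WithZero

variable {k : Type u} [Field k] [NumberField k]

lemma exists_exp_neg_lt {g : ℤᵐ⁰} (hg : g ≠ 0) : ∃ n : ℕ, exp (-(n : ℤ)) < g := by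
  refine ⟨(1 - log g).toNat, ?_⟩
  rw [← lt_log_iff_exp_lt hg]
  have := Int.self_le_toNat (1 - log g)
  omega

lemma valued_algebraMap (v : HeightOneSpectrum (𝓞 k)) (x : k) :
    Valued.v (algebraMap k (v.adicCompletion k) x) = v.valuation k x :=
  v.valuedAdicCompletion_eq_valuation' x

omit [NumberField k] in
lemma norm_algebraMap_completion (v : InfinitePlace k) (x : k) :
    ‖algebraMap k v.Completion x‖ = v x :=
  InfinitePlace.Completion.norm_coe v (WithAbs.toAbs v.1 x)

lemma exists_exp_ball_subset (v : HeightOneSpectrum (𝓞 k)) {W : Set (v.adicCompletion k)}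
    (hW : IsOpen W) {x : v.adicCompletion k} (hx : x ∈ W) :
    ∃ n : ℕ, ∀ y, Valued.v (y - x) ≤ exp (-(n : ℤ)) → y ∈ W := by
  obtain ⟨γ, hγ⟩ := Valued.mem_nhds.mp (hW.mem_nhds hx)
  obtain ⟨n, hn⟩ := exists_exp_neg_lt (g := MonoidWithZeroHom.ValueGroup₀.embedding γ.1)
    (by simp)
  refine ⟨n, fun y hy ↦ hγ ?_⟩
  change Valued.v.restrict (y - x) < γ.1
  rw [Valuation.restrict_lt_iff_lt_embedding]
  exact hy.trans_lt hn

lemma finite_setOf_valuation_ne_one {x : k} (hx : x ≠ 0) :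
    {v : HeightOneSpectrum (𝓞 k) | v.valuation k x ≠ 1}.Finite := by
  have key (a : 𝓞 k) (ha : a ≠ 0) :
      {v : HeightOneSpectrum (𝓞 k) | v.valuation k (algebraMap (𝓞 k) k a) ≠ 1}.Finite := by
    refine (Ideal.finite_factors (I := Ideal.span {a}) (by simpa using ha)).subset fun v hv ↦ ?_
    rw [Set.mem_ofPred_eq, ← v.valuation_lt_one_iff_dvd (K := k)]
    exact lt_of_le_of_ne (v.valuation_le_one a) hv
  obtain ⟨a, b, hb, rfl⟩ := IsFractionRing.div_surjective (A := 𝓞 k) x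
  have ha : a ≠ 0 := by rintro rfl; simp at hx
  refine ((key a ha).union (key b (nonZeroDivisors.ne_zero hb))).subset fun v hv ↦ ?_
  by_contra hcon
  rw [Set.mem_union, not_or] at hcon
  simp only [Set.mem_ofPred_eq, not_not] at hcon
  exact hv (by rw [map_div₀, hcon.1, hcon.2, div_one])

lemma finite_setOf_one_lt_valuation (x : k) :
    {v : HeightOneSpectrum (𝓞 k) | 1 < v.valuation k x}.Finite := by
  by_cases hx : x = 0
  · simp [hx]
  · exact (finite_setOf_valuation_ne_one hx).subset fun v hv ↦ ne_of_gt hv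

/-- The ring of integers is cocompact at the archimedean places. -/
lemma exists_integer_sub_le (k : Type u) [Field k] [NumberField k] :
    ∃ C : ℝ, 0 < C ∧ ∀ q : k, ∃ a : 𝓞 k, ∀ v : InfinitePlace k, v (q - a) ≤ C := by
  let b := integralBasis k
  obtain ⟨C, hC⟩ := (Set.finite_range fun v : InfinitePlace k ↦ ∑ i, v (b i)).bddAbove
  refine ⟨max C 1, lt_max_of_lt_right one_pos, fun q ↦ ?_⟩
  -- Rounding down the coordinates in an integral basis leaves fractional parts in `[0, 1)`, so the
  -- remainder is bounded by the sum of the absolute values of the basis elements.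
  refine ⟨∑ i, ⌊b.repr q i⌋ • RingOfIntegers.basis k i, fun v ↦
    le_trans ?_ ((hC ⟨v, rfl⟩).trans (le_max_left _ _))⟩
  have : q - (∑ i, ⌊b.repr q i⌋ • RingOfIntegers.basis k i : 𝓞 k) =
      ∑ i, (algebraMap ℚ k (Int.fract (b.repr q i))) * b i := by
    have h1 : ((∑ i, ⌊b.repr q i⌋ • RingOfIntegers.basis k i : 𝓞 k) : k) =
        ∑ i, (⌊b.repr q i⌋ : k) * b i := by
      simp [b, integralBasis_apply]
    have h2 : q = ∑ i, algebraMap ℚ k (b.repr q i) * b i := by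
      simpa only [Algebra.smul_def] using (b.sum_repr q).symm
    rw [h1, sub_eq_iff_eq_add, ← Finset.sum_add_distrib]
    refine h2.trans (Finset.sum_congr rfl fun i _ ↦ ?_)
    rw [← add_mul, Int.fract, map_sub]
    simp
  rw [this]
  refine (v.1.sum_le _ _).trans (Finset.sum_le_sum fun i _ ↦ ?_)
  change v (_ * _) ≤ v _
  rw [map_mul]
  refine mul_le_of_le_one_left (apply_nonneg _ _) ?_
  have h1 : v (algebraMap ℚ k (Int.fract (b.repr q i))) = |(Int.fract (b.repr q i) : ℝ)| := by
    rw [← InfinitePlace.norm_embedding_eq]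
    simp
  rw [h1, abs_le]
  constructor
  · linarith [Int.fract_nonneg (b.repr q i : ℝ)]
  · exact (Int.fract_lt_one _).le

/-- The class group is finite, so its order serves as the exponent. -/
lemma exists_principal_power (p : HeightOneSpectrum (𝓞 k)) :
    ∃ (h : ℕ) (π : 𝓞 k), h ≠ 0 ∧ p.asIdeal ^ h = Ideal.span {π} := by
  refine ⟨Fintype.card (ClassGroup (𝓞 k)), ?_⟩
  have hp : p.asIdeal ∈ nonZeroDivisors (Ideal (𝓞 k)) := mem_nonZeroDivisors_of_ne_zero p.ne_bot
  have h1 : ClassGroup.mk0 ⟨p.asIdeal ^ Fintype.card (ClassGroup (𝓞 k)), pow_mem hp _⟩ = 1 := by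
    rw [← pow_card_eq_one (x := ClassGroup.mk0 ⟨p.asIdeal, hp⟩), ← map_pow]
    rfl
  obtain ⟨π, hπ⟩ := (ClassGroup.mk0_eq_one_iff _).mp h1
  exact ⟨π, Fintype.card_ne_zero, hπ⟩

open mixedEmbedding in
lemma exists_integer_lt (f : InfinitePlace k → NNReal)
    (h : minkowskiBound k 1 < convexBodyLTFactor k * ∏ w, (f w : ENNReal) ^ w.mult) :
    ∃ a : 𝓞 k, a ≠ 0 ∧ ∀ w : InfinitePlace k, w a < f w := by
  refine exists_ne_zero_mem_ringOfIntegers_lt k ?_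
  rw [convexBodyLT_volume]
  exact_mod_cast h

open mixedEmbedding in
/-- There are nonzero elements that are small at all archimedean places and integral at all
non-archimedean places, with the exception of a single given place. -/
lemma exists_small (v₀ : Place k) {ε : ℝ} (hε : 0 < ε) : ∃ c : k, c ≠ 0 ∧
    (∀ v : InfinitePlace k, Sum.inl v ≠ v₀ → v c < ε) ∧
    ∀ v : HeightOneSpectrum (𝓞 k), Sum.inr v ≠ v₀ → v.valuation k c ≤ 1 := by
  obtain ⟨B, hB⟩ : ∃ B : NNReal, minkowskiBound k 1 < convexBodyLTFactor k * (B : ENNReal) := by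
    refine ⟨(minkowskiBound k 1).toNNReal + 1, ?_⟩
    have hlt := minkowskiBound_lt_top k 1
    refine lt_of_lt_of_le ?_ (le_mul_of_one_le_left zero_le
      (by exact_mod_cast one_le_convexBodyLTFactor k))
    rw [ENNReal.coe_add, ENNReal.coe_toNNReal hlt.ne]
    exact ENNReal.lt_add_right hlt.ne (by simp)
  cases v₀ with
  | inl w₀ =>
    -- The exceptional place is archimedean: the box may be as long as Minkowski's theorem requires
    -- in that direction.
    obtain ⟨g, hg, hgB⟩ := adjust_f k (f := fun _ ↦ ε.toNNReal) (w₁ := w₀) B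
      (fun _ _ ↦ by simpa using hε)
    obtain ⟨a, ha, hlt⟩ := exists_integer_lt g (by
      rw [← hgB] at hB
      exact_mod_cast hB)
    refine ⟨a, by simpa using ha, fun v hv ↦ ?_, fun v _ ↦ v.valuation_le_one a⟩
    have := hlt v
    rw [hg v (by simpa using hv), Real.coe_toNNReal _ hε.le] at this
    exact this
  | inr p =>
    -- The exceptional place `p` is finite: `π` is divisible by no other prime, so dividing by `π ^
    -- j` costs integrality at `p` only. Scaling the box by `π ^ j` multiplies its volume by `N ^
    -- j`, where `N > 1` is the absolute norm of `π`.
    obtain ⟨h, π, hh, hπ⟩ := exists_principal_power p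
    have hπ0 : π ≠ 0 := by
      rintro rfl
      rw [Ideal.span_singleton_eq_bot.mpr rfl] at hπ
      exact pow_ne_zero h p.ne_bot hπ
    have hπ0' : (π : k) ≠ 0 := by simpa using hπ0
    have hunit : ¬ IsUnit π := by
      rw [← Ideal.span_singleton_eq_top, ← hπ]
      exact ((Ideal.pow_le_self hh).trans_lt p.isPrime.ne_top.lt_top).ne
    let m (w : InfinitePlace k) : NNReal := (w (π : k)).toNNReal
    have hm (w : InfinitePlace k) : (m w : ℝ) = w (π : k) :=
      Real.coe_toNNReal _ (apply_nonneg w _)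
    set N : NNReal := ∏ w : InfinitePlace k, m w ^ w.mult with hN
    have hN1 : 1 < N := by
      have h1 : (N : ℝ) = Ideal.absNorm (Ideal.span {π}) := by
        rw [hN, Ideal.absNorm_span_singleton, Nat.cast_natAbs]
        push_cast
        simp only [hm]
        refine (InfinitePlace.prod_eq_abs_norm (π : k)).trans ?_
        rw [← Algebra.coe_norm_int]
        push_cast
        rfl
      have h2 : 1 < Ideal.absNorm (Ideal.span {π}) := by
        have h3 : Ideal.absNorm (Ideal.span {π}) ≠ 0 := by
          simpa [Ideal.absNorm_eq_zero_iff] using hπ0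
        have h4 : Ideal.absNorm (Ideal.span {π}) ≠ 1 := by
          rwa [Ne, Ideal.absNorm_eq_one_iff, Ideal.span_singleton_eq_top]
        omega
      have : (1 : ℝ) < N := by rw [h1]; exact_mod_cast h2
      exact_mod_cast this
    set E : NNReal := ∏ w : InfinitePlace k, ε.toNNReal ^ w.mult
    have hE : E ≠ 0 := Finset.prod_ne_zero_iff.mpr fun w _ ↦ pow_ne_zero _ (by simpa using hε)
    obtain ⟨j, hj⟩ : ∃ j : ℕ, B < E * N ^ j := by
      obtain ⟨j, hj⟩ := pow_unbounded_of_one_lt (B / E) hN1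
      exact ⟨j, by rwa [div_lt_iff₀' (pos_iff_ne_zero.mpr hE)] at hj⟩
    obtain ⟨a, ha, hlt⟩ := exists_integer_lt
      (fun w ↦ ε.toNNReal * m w ^ j) (by
        refine hB.trans_le (mul_le_mul_right ?_ _)
        have : E * N ^ j = ∏ w : InfinitePlace k,
            (ε.toNNReal * m w ^ j) ^ w.mult := by
          simp only [E, hN, mul_pow, Finset.prod_mul_distrib, ← Finset.prod_pow, ← pow_mul,
            mul_comm]
        rw [this] at hj
        exact_mod_cast hj.le)
    refine ⟨a / π ^ j, div_ne_zero (by simpa using ha) (pow_ne_zero _ hπ0'), fun v _ ↦ ?_,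
      fun v hv ↦ ?_⟩
    · have := hlt v
      rw [map_div₀, map_pow, div_lt_iff₀ (pow_pos (v.pos_iff.mpr hπ0') _)]
      simpa [hε.le, hm] using this
    · have h1 : v.valuation k (π : k) = 1 := by
        rw [HeightOneSpectrum.valuation_eq_one_iff_notMem]
        intro hmem
        have h2 : p.asIdeal ^ h ≤ v.asIdeal := by
          rw [hπ]
          simpa [Ideal.span_le] using hmem
        have h3 := p.isMaximal.eq_of_le v.isPrime.ne_top (v.isPrime.le_of_pow_le h2)
        exact hv (congrArg _ (HeightOneSpectrum.ext h3.symm))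
      rw [map_div₀, map_pow, h1, one_pow, div_one]
      exact v.valuation_le_one a

end Line

/-! ### Combining the finite and the archimedean approximations -/

section Line

open WithZero

variable {k : Type u} [Field k] [NumberField k]

lemma exists_exp_neg_le_mul (v : HeightOneSpectrum (𝓞 k)) (n : ℕ) {D : k} (hD : D ≠ 0) :
    ∃ e : ℕ, exp (-(e : ℤ)) ≤ exp (-(n : ℤ)) * v.valuation k D := by
  obtain ⟨e, he⟩ := exists_exp_neg_lt (g := exp (-(n : ℤ)) * v.valuation k D)
    (mul_ne_zero exp_ne_zero (by simpa using hD))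
  exact ⟨e, he.le⟩

/-- Approximation at finitely many non-archimedean places by elements that are integral at all
other non-archimedean places. -/
lemma exists_approx_finite (T : Finset (HeightOneSpectrum (𝓞 k)))
    (x : HeightOneSpectrum (𝓞 k) → k) (n : ℕ) :
    ∃ t : k, (∀ v ∈ T, v.valuation k (t - x v) ≤ exp (-(n : ℤ))) ∧
      ∀ v ∉ T, v.valuation k t ≤ 1 := by
  classical
  obtain ⟨D, hD⟩ := IsLocalization.exist_integer_multiples_of_finset (nonZeroDivisors (𝓞 k))
    (T.image x)
  have hD0 : (algebraMap (𝓞 k) k D) ≠ 0 := by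
    simp
  have hy (v) (hv : v ∈ T) : ∃ a : 𝓞 k, algebraMap (𝓞 k) k a = algebraMap (𝓞 k) k D * x v := by
    obtain ⟨a, ha⟩ := hD (x v) (Finset.mem_image_of_mem x hv)
    exact ⟨a, by rw [ha, Algebra.smul_def]⟩
  choose! a ha using hy
  -- The approximation is `y / D` with a common denominator `D`. At places of `T` the integer `y`
  -- approximates `D * x v`; at the other places dividing `D` it is close to `0`, which keeps the
  -- quotient integral.
  let T' := T ∪ (finite_setOf_valuation_ne_one hD0).toFinset
  choose e he using fun v : HeightOneSpectrum (𝓞 k) ↦ exists_exp_neg_le_mul v n hD0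
  obtain ⟨y, hy⟩ := IsDedekindDomain.exists_forall_sub_mem_ideal (s := T')
    (fun v : HeightOneSpectrum (𝓞 k) ↦ v.asIdeal) e (fun v _ ↦ v.prime)
    (fun v _ w _ hvw h ↦ hvw (HeightOneSpectrum.ext h)) (fun v ↦ if v.1 ∈ T then a v.1 else 0)
  have hval (v : HeightOneSpectrum (𝓞 k)) (r : 𝓞 k) (hr : r ∈ v.asIdeal ^ e v) :
      v.valuation k (algebraMap (𝓞 k) k r) ≤
        exp (-(n : ℤ)) * v.valuation k (algebraMap (𝓞 k) k D) := by
    refine le_trans ?_ (he v)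
    rwa [v.valuation_of_algebraMap, v.intValuation_le_pow_iff_mem]
  have hpos (v : HeightOneSpectrum (𝓞 k)) : 0 < v.valuation k (algebraMap (𝓞 k) k D) :=
    zero_lt_iff.mpr (by simp [hD0])
  refine ⟨algebraMap (𝓞 k) k y / algebraMap (𝓞 k) k D, fun v hv ↦ ?_, fun v hv ↦ ?_⟩
  · have h1 := hval v _ (hy v (Finset.mem_union_left _ hv))
    rw [if_pos hv, map_sub, ha v hv] at h1
    have h2 : algebraMap (𝓞 k) k y / algebraMap (𝓞 k) k D - x v =
        (algebraMap (𝓞 k) k y - algebraMap (𝓞 k) k D * x v) / algebraMap (𝓞 k) k D := by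
      field_simp
    rw [h2, map_div₀]
    exact (div_le_iff₀ (hpos v)).mpr h1
  · rw [map_div₀]
    by_cases hv' : v ∈ T'
    · have h1 := hval v _ (hy v hv')
      rw [if_neg hv, sub_zero] at h1
      refine (div_le_iff₀ (hpos v)).mpr (h1.trans (mul_le_mul_left ?_ _))
      rw [← exp_zero, exp_le_exp]
      simp
    · have h1 : v.valuation k (algebraMap (𝓞 k) k D) = 1 := by
        by_contra h
        exact hv' (Finset.mem_union_right _ ((finite_setOf_valuation_ne_one hD0).mem_toFinset.mpr h))
      rw [h1, div_one]
      exact v.valuation_le_one y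

lemma exists_integer_valuation_le (T : Finset (HeightOneSpectrum (𝓞 k))) (n : ℕ) :
    ∃ D : 𝓞 k, D ≠ 0 ∧ ∀ v ∈ T, v.valuation k (D : k) ≤ exp (-(n : ℤ)) := by
  classical
  have h0 : ∏ v ∈ T, v.asIdeal ^ n ≠ ⊥ :=
    Finset.prod_ne_zero_iff.mpr fun v _ ↦ pow_ne_zero n v.ne_bot
  obtain ⟨D, hD, hD0⟩ := Submodule.exists_mem_ne_zero_of_ne_bot h0
  refine ⟨D, hD0, fun v hv ↦ ?_⟩
  rw [v.valuation_of_algebraMap, v.intValuation_le_pow_iff_mem]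
  exact Ideal.le_of_dvd (Finset.dvd_prod_of_mem _ hv) hD

/-- Strong approximation for the affine line. -/
theorem exists_mem_of_isOpen (S : Finset (Place k)) (hS : S.Nonempty)
    (T : Finset (HeightOneSpectrum (𝓞 k)))
    (W : ∀ v : InfinitePlace k, Set v.Completion)
    (W' : ∀ v : HeightOneSpectrum (𝓞 k), Set (v.adicCompletion k))
    (hW : ∀ v, Sum.inl v ∉ S → IsOpen (W v) ∧ (W v).Nonempty)
    (hW' : ∀ v ∈ T, Sum.inr v ∉ S → IsOpen (W' v) ∧ (W' v).Nonempty) :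
    ∃ t : k, (∀ v, Sum.inl v ∉ S → algebraMap k v.Completion t ∈ W v) ∧
      (∀ v ∈ T, Sum.inr v ∉ S → algebraMap k (v.adicCompletion k) t ∈ W' v) ∧
      ∀ v ∉ T, Sum.inr v ∉ S → v.valuation k t ≤ 1 := by
  classical
  obtain ⟨v₀, hv₀⟩ := hS
  -- an approximation at the archimedean places
  obtain ⟨q, ε, hε, hq⟩ : ∃ (q : k) (ε : ℝ), 0 < ε ∧ ∀ v, Sum.inl v ∉ S →
      ∀ y, ‖y - algebraMap k v.Completion q‖ < ε → y ∈ W v := by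
    let O : Set (InfiniteAdeleRing k) :=
      Set.pi Set.univ fun v : InfinitePlace k ↦ if Sum.inl v ∈ S then Set.univ else W v
    have hO : IsOpen O := isOpen_set_pi Set.finite_univ fun v _ ↦ by
      split_ifs with h
      exacts [isOpen_univ, (hW v h).1]
    have hne : O.Nonempty := Set.univ_pi_nonempty_iff.mpr fun v ↦ by
      split_ifs with h
      exacts [Set.univ_nonempty, (hW v h).2]
    obtain ⟨q, hq⟩ := (InfiniteAdeleRing.denseRange_algebraMap k).exists_mem_open hO hne
    have hqW (v : InfinitePlace k) (hv : Sum.inl v ∉ S) : algebraMap k v.Completion q ∈ W v := by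
      have := hq v (Set.mem_univ v)
      simpa only [hv, if_false] using! this
    have hball (v : InfinitePlace k) : ∃ ε : ℝ, 0 < ε ∧ (Sum.inl v ∉ S →
        ∀ y, ‖y - algebraMap k v.Completion q‖ < ε → y ∈ W v) := by
      by_cases hv : Sum.inl v ∈ S
      · exact ⟨1, one_pos, fun h ↦ absurd hv h⟩
      · obtain ⟨ε, hε, h⟩ := Metric.isOpen_iff.mp (hW v hv).1 _ (hqW v hv)
        exact ⟨ε, hε, fun _ y hy ↦ h (by rwa [Metric.mem_ball, dist_eq_norm])⟩
    choose ε hε hball using hball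
    refine ⟨q, Finset.univ.inf' Finset.univ_nonempty ε, ?_, fun v hv y hy ↦
      hball v hv y (hy.trans_le (Finset.inf'_le _ (Finset.mem_univ v)))⟩
    exact (Finset.lt_inf'_iff _).mpr fun v _ ↦ hε v
  -- an approximation at the non-archimedean places
  obtain ⟨t₁, n, ht₁, ht₁'⟩ : ∃ (t : k) (n : ℕ), (∀ v ∈ T, Sum.inr v ∉ S →
      ∀ y, Valued.v (y - algebraMap k (v.adicCompletion k) t) ≤ exp (-(n : ℤ)) → y ∈ W' v) ∧
      ∀ v ∉ T, v.valuation k t ≤ 1 := by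
    have h1 (v) : ∃ (x : k) (n : ℕ), v ∈ T → Sum.inr v ∉ S → ∀ y,
        Valued.v (y - algebraMap k (v.adicCompletion k) x) ≤ exp (-(n : ℤ)) → y ∈ W' v := by
      by_cases hv : v ∈ T ∧ Sum.inr v ∉ S
      · obtain ⟨x, hx⟩ := (v.denseRange_algebraMap k).exists_mem_open (hW' v hv.1 hv.2).1
          (hW' v hv.1 hv.2).2
        obtain ⟨n, hn⟩ := exists_exp_ball_subset v (hW' v hv.1 hv.2).1 hx
        exact ⟨x, n, fun _ _ ↦ hn⟩
      · exact ⟨0, 0, fun h h' ↦ absurd ⟨h, h'⟩ hv⟩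
    choose x n hxn using h1
    obtain ⟨t, ht, ht'⟩ := exists_approx_finite T x (T.sup n)
    refine ⟨t, T.sup n, fun v hv hvS y hy ↦ hxn v hv hvS y ?_, ht'⟩
    have h2 : exp (-((T.sup n : ℕ) : ℤ)) ≤ exp (-(n v : ℤ)) := by
      rw [exp_le_exp, neg_le_neg_iff]
      exact_mod_cast Finset.le_sup hv
    have h3 : y - algebraMap k (v.adicCompletion k) (x v) =
        (y - algebraMap k (v.adicCompletion k) t) +
          algebraMap k (v.adicCompletion k) (t - x v) := by
      rw [map_sub]; ring
    rw [h3]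
    refine Valuation.map_add_le _ (hy.trans h2) ?_
    rw [valued_algebraMap]
    exact (ht v hv).trans h2
  obtain ⟨D, hD0, hD⟩ := exists_integer_valuation_le T n
  have hD0' : (D : k) ≠ 0 := by simpa using hD0
  obtain ⟨C, hC, hcov⟩ := exists_integer_sub_le k
  obtain ⟨M, hM0, hM⟩ : ∃ M : ℝ, 0 < M ∧ ∀ v : InfinitePlace k, v (D : k) ≤ M := by
    obtain ⟨M, hM⟩ := (Set.finite_range fun v : InfinitePlace k ↦ v (D : k)).bddAbove
    exact ⟨max M 1, lt_max_of_lt_right one_pos, fun v ↦ (hM ⟨v, rfl⟩).trans (le_max_left _ _)⟩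
  -- The correction `c * D * a` moves `t₁` near `q` at the archimedean places: `c` is small there,
  -- `D` keeps the correction small at `T`, and `a` rounds the quotient. The error is at most `v c *
  -- M * C`, hence below `ε`.
  obtain ⟨c, hc0, hc, hc'⟩ := exists_small v₀ (ε := ε / (M * C)) (by positivity)
  obtain ⟨a, ha⟩ := hcov ((q - t₁) / (c * D))
  have hne {v : Place k} (hv : v ∉ S) : v ≠ v₀ := fun h ↦ hv (h ▸ hv₀)
  have ha1 (v : HeightOneSpectrum (𝓞 k)) : v.valuation k (a : k) ≤ 1 := v.valuation_le_one a
  refine ⟨t₁ + c * D * a, fun v hv ↦ hq v hv _ ?_, fun v hv hvS ↦ ht₁ v hv hvS _ ?_,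
    fun v hv hvS ↦ Valuation.map_add_le _ (ht₁' v hv) ?_⟩
  · rw [← map_sub, norm_algebraMap_completion]
    have h1 : t₁ + c * D * a - q = -(c * D * ((q - t₁) / (c * D) - a)) := by
      field_simp
      ring
    have h2 : v (t₁ + c * D * a - q) = v c * v (D : k) * v ((q - t₁) / (c * D) - a) := by
      rw [h1, ← map_mul, ← map_mul]
      exact v.1.map_neg _
    rw [h2]
    calc v c * v (D : k) * v ((q - t₁) / (c * D) - a) ≤ v c * M * C := by
          have := hM v
          have := ha v
          have h3 : 0 ≤ v ((q - t₁) / (c * D) - a) := apply_nonneg v _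
          gcongr
      _ < ε / (M * C) * M * C := by
          have := hc v (hne hv)
          gcongr
      _ = ε := by field_simp
  · rw [← map_sub, valued_algebraMap, add_sub_cancel_left, map_mul, map_mul]
    calc _ ≤ 1 * exp (-(n : ℤ)) * 1 :=
          mul_le_mul' (mul_le_mul' (hc' v (hne hvS)) (hD v hv)) (ha1 v)
      _ = _ := by simp
  · rw [map_mul, map_mul]
    exact mul_le_one' (mul_le_one' (hc' v (hne hvS)) (v.valuation_le_one D)) (ha1 v)

end Line

/-! ### Approximation by points that stay away from a subset of codimension two -/

section AffineSpace

open MvPolynomial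

variable {k : Type u} [Field k] [NumberField k]

/-- The polynomials `f` and `g` satisfy strong approximation off `S` in the sense that, for a
sufficiently large finite set `T` of places, one can approximate at the places in `T` by rational
points that are integral outside of `T` and at which one of `f` and `g` is not divisible by `v`,
for each `v ∉ T`. -/
def ApproximablePair {n : ℕ} (S : Finset (Place k)) (f g : MvPolynomial (Fin n) k) : Prop :=
  ∃ B : Finset (HeightOneSpectrum (𝓞 k)), ∀ T : Finset (HeightOneSpectrum (𝓞 k)), B ⊆ T →
    ∀ (W : ∀ v : InfinitePlace k, Set (Fin n → v.Completion))
      (W' : ∀ v : HeightOneSpectrum (𝓞 k), Set (Fin n → v.adicCompletion k)),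
    (∀ v, Sum.inl v ∉ S → IsOpen (W v) ∧ (W v).Nonempty) →
    (∀ v ∈ T, Sum.inr v ∉ S → IsOpen (W' v) ∧ (W' v).Nonempty) →
    ∃ y : Fin n → k,
      (∀ v, Sum.inl v ∉ S → (fun i ↦ algebraMap k v.Completion (y i)) ∈ W v) ∧
      (∀ v ∈ T, Sum.inr v ∉ S → (fun i ↦ algebraMap k (v.adicCompletion k) (y i)) ∈ W' v) ∧
      (∀ v ∉ T, Sum.inr v ∉ S → (∀ i, v.valuation k (y i) ≤ 1) ∧
        (1 ≤ v.valuation k (eval y f) ∨ 1 ≤ v.valuation k (eval y g))) ∧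
      (eval y f ≠ 0 ∨ eval y g ≠ 0)

lemma exists_box {F : Type*} [TopologicalSpace F] {n : ℕ} {W : Set (Fin n → F)} (hW : IsOpen W)
    (hne : W.Nonempty) :
    ∃ u : Fin n → Set F, (∀ i, IsOpen (u i) ∧ (u i).Nonempty) ∧ Set.pi Set.univ u ⊆ W := by
  obtain ⟨x, hx⟩ := hne
  obtain ⟨u, hu, hsub⟩ := isOpen_pi_iff'.mp hW x hx
  exact ⟨u, fun i ↦ ⟨(hu i).1, x i, (hu i).2⟩, hsub⟩

/-- Strong approximation for affine spaces. -/
theorem exists_mem_of_isOpen_pi {n : ℕ} (S : Finset (Place k)) (hS : S.Nonempty)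
    (T : Finset (HeightOneSpectrum (𝓞 k)))
    (W : ∀ v : InfinitePlace k, Set (Fin n → v.Completion))
    (W' : ∀ v : HeightOneSpectrum (𝓞 k), Set (Fin n → v.adicCompletion k))
    (hW : ∀ v, Sum.inl v ∉ S → IsOpen (W v) ∧ (W v).Nonempty)
    (hW' : ∀ v ∈ T, Sum.inr v ∉ S → IsOpen (W' v) ∧ (W' v).Nonempty) :
    ∃ y : Fin n → k, (∀ v, Sum.inl v ∉ S → (fun i ↦ algebraMap k v.Completion (y i)) ∈ W v) ∧
      (∀ v ∈ T, Sum.inr v ∉ S → (fun i ↦ algebraMap k (v.adicCompletion k) (y i)) ∈ W' v) ∧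
      ∀ v ∉ T, Sum.inr v ∉ S → ∀ i, v.valuation k (y i) ≤ 1 := by
  have h1 (v : InfinitePlace k) : ∃ u : Fin n → Set v.Completion, Sum.inl v ∉ S →
      (∀ i, IsOpen (u i) ∧ (u i).Nonempty) ∧ Set.pi Set.univ u ⊆ W v := by
    by_cases hv : Sum.inl v ∉ S
    · obtain ⟨u, hu⟩ := exists_box (hW v hv).1 (hW v hv).2
      exact ⟨u, fun _ ↦ hu⟩
    · exact ⟨fun _ ↦ ∅, fun h ↦ absurd h hv⟩
  have h2 (v : HeightOneSpectrum (𝓞 k)) : ∃ u : Fin n → Set (v.adicCompletion k), v ∈ T →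
      Sum.inr v ∉ S → (∀ i, IsOpen (u i) ∧ (u i).Nonempty) ∧ Set.pi Set.univ u ⊆ W' v := by
    by_cases hv : v ∈ T ∧ Sum.inr v ∉ S
    · obtain ⟨u, hu⟩ := exists_box (hW' v hv.1 hv.2).1 (hW' v hv.1 hv.2).2
      exact ⟨u, fun _ _ ↦ hu⟩
    · exact ⟨fun _ ↦ ∅, fun h h' ↦ absurd ⟨h, h'⟩ hv⟩
  choose u hu using h1
  choose u' hu' using h2
  choose y hy using fun i : Fin n ↦ exists_mem_of_isOpen S hS T (fun v ↦ u v i)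
    (fun v ↦ u' v i) (fun v hv ↦ (hu v hv).1 i) (fun v hvT hv ↦ (hu' v hvT hv).1 i)
  exact ⟨y, fun v hv ↦ (hu v hv).2 fun i _ ↦ (hy i).1 v hv,
    fun v hvT hv ↦ (hu' v hvT hv).2 fun i _ ↦ (hy i).2.1 v hvT hv,
    fun v hvT hv i ↦ (hy i).2.2 v hvT hv⟩

lemma exists_place_notMem (T : Finset (HeightOneSpectrum (𝓞 k))) : ∃ v, v ∉ T := by
  -- As in Euclid's argument: `D` lies in all primes of `T` and divides its norm `N`, so a prime
  -- containing `N + 1` is not in `T`.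
  obtain ⟨D, hD0, hD⟩ := exists_integer_valuation_le T 1
  set N := Ideal.absNorm (Ideal.span {D})
  have hN0 : N ≠ 0 := by simpa [N, Ideal.absNorm_eq_zero_iff] using hD0
  have hDN : D ∣ (N : 𝓞 k) := Ideal.mem_span_singleton.mp (Ideal.absNorm_mem _)
  have hne : Ideal.span {((N + 1 : ℕ) : 𝓞 k)} ≠ ⊤ := by
    intro h
    have h1 := Ideal.absNorm_span_natCast (S := 𝓞 k) (N + 1)
    rw [h, Ideal.absNorm_top] at h1
    have h2 : Module.finrank ℤ (𝓞 k) ≠ 0 := Module.finrank_pos.ne'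
    have h3 := Nat.one_lt_pow h2 (show 1 < N + 1 by omega)
    omega
  obtain ⟨m, hm, hle⟩ := Ideal.exists_le_maximal _ hne
  have hmem : ((N + 1 : ℕ) : 𝓞 k) ∈ m := hle (Ideal.mem_span_singleton_self _)
  have hm0 : m ≠ ⊥ := by
    rintro rfl
    rw [Ideal.mem_bot, Nat.cast_eq_zero] at hmem
    omega
  refine ⟨⟨m, hm.isPrime, hm0⟩, fun hv ↦ ?_⟩
  have h1 : D ∈ m := by
    have := (hD _ hv).trans_lt (WithZero.exp_lt_exp.mpr (show (-(1 : ℕ) : ℤ) < 0 by simp))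
    rw [WithZero.exp_zero] at this
    exact (HeightOneSpectrum.valuation_lt_one_iff_mem _ _).mp this
  refine hm.ne_top ((Ideal.eq_top_iff_one m).mpr ?_)
  have h2 := m.sub_mem hmem (m.mem_of_dvd hDN h1)
  simpa using h2

lemma isOpen_setOf_valued_le_one (v : HeightOneSpectrum (𝓞 k)) :
    IsOpen {x : v.adicCompletion k | Valued.v x ≤ 1} :=
  Valued.isOpen_integer (v.adicCompletion k)

lemma isOpen_setOf_one_le_valued (v : HeightOneSpectrum (𝓞 k)) :
    IsOpen {x : v.adicCompletion k | 1 ≤ Valued.v x} := by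
  have h := (Valued.isClosed_ball (v.adicCompletion k) 1).isOpen_compl
  convert h using 1
  ext x
  simp [Valuation.restrict_lt_one_iff]

/-- If the place `v` does not divide `d!`, then a monic polynomial of degree `d` takes a value
that is not divisible by `v` at one of the integers `0, …, d`. -/
lemma exists_nat_one_le_valuation_eval (v : HeightOneSpectrum (𝓞 k)) {p : Polynomial k}
    (hp : p.Monic) (hv : v.valuation k (p.natDegree.factorial : k) = 1) :
    ∃ i : ℕ, 1 ≤ v.valuation k (p.eval (i : k)) := by
  by_contra! hcon
  -- The iterated finite difference equals the factorial, and it is a combination of values of `p`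
  -- with integer coefficients. If `v` divided all these values, it would divide the factorial.
  have h1 := congrFun p.fwdDiff_iter_degree_eq_factorial 0
  rw [fwdDiff_iter_eq_sum_shift, hp.leadingCoeff, one_smul] at h1
  have h2 : v.valuation k (p.natDegree.factorial : k) < 1 := by
    have h3 : (p.natDegree.factorial : k) = ((p.natDegree.factorial : k → k)) 0 := rfl
    rw [h3, ← h1]
    refine Valuation.map_sum_lt _ one_ne_zero fun i _ ↦ ?_
    rw [zsmul_eq_mul, map_mul]
    refine (mul_le_mul_left ?_ _).trans_lt ((one_mul _).trans_lt (by simpa using hcon i))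
    simpa using v.valuation_le_one (K := k)
      (((-1) ^ (p.natDegree - i) * (p.natDegree.choose i : ℤ) : ℤ) : 𝓞 k)
  exact h2.ne hv

/-- The natural numbers are an infinite subset of `k`. Such a point is integral at every finite
place, so it shows that the open condition imposed at an auxiliary place can be met. -/
lemma exists_natCast_eval_ne_zero {n : ℕ} {r : MvPolynomial (Fin n) k} (hr : r ≠ 0) :
    ∃ a : Fin n → ℕ, eval (fun i ↦ (a i : k)) r ≠ 0 := by
  by_contra! hcon
  refine hr (MvPolynomial.funext_set (fun _ ↦ Set.range ((↑) : ℕ → k))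
    (fun _ ↦ Set.infinite_range_of_injective Nat.cast_injective) fun x hx ↦ ?_)
  choose a ha using fun i ↦ hx i (Set.mem_univ i)
  rw [map_zero, ← hcon a]
  exact congrArg (fun x ↦ eval x r) (funext fun i ↦ (ha i).symm)

omit [NumberField k] in
lemma eval_algebraMap_comp {F : Type*} [CommRing F] [Algebra k F] {n : ℕ} (y : Fin n → k)
    (p : MvPolynomial (Fin n) k) :
    aeval (fun i ↦ algebraMap k F (y i)) p = algebraMap k F (eval y p) := by
  rw [← MvPolynomial.coe_aeval_eq_eval]
  exact MvPolynomial.aeval_algebraMap_apply _ _ _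

omit [NumberField k] in
lemma continuous_aeval {F : Type*} [CommRing F] [Algebra k F] [TopologicalSpace F]
    [IsTopologicalRing F] {n : ℕ} (p : MvPolynomial (Fin n) k) :
    Continuous fun y : Fin n → F ↦ aeval y p := by
  simp only [aeval_def, eval₂_eq_eval_map]
  exact MvPolynomial.continuous_eval _

theorem approximablePair_of_monic {n : ℕ} (S : Finset (Place k)) (hS : S.Nonempty)
    (f : MvPolynomial (Fin (n + 1)) k) (r : MvPolynomial (Fin n) k)
    (hf : (MvPolynomial.finSuccEquiv k n f).Monic) (hr : r ≠ 0) :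
    ApproximablePair S f (rename Fin.succ r) := by
  classical
  set d := (MvPolynomial.finSuccEquiv k n f).natDegree with hd
  have hd0 : (d.factorial : k) ≠ 0 := by exact_mod_cast d.factorial_ne_zero
  refine ⟨(finite_setOf_valuation_ne_one hd0).toFinset, fun T hT W W' hW hW' ↦ ?_⟩
  have hbox (F : Type u) [TopologicalSpace F] (V : Set (Fin (n + 1) → F))
      (hV : IsOpen V ∧ V.Nonempty) : ∃ (V₀ : Set F) (V₁ : Set (Fin n → F)),
      (IsOpen V₀ ∧ V₀.Nonempty) ∧ (IsOpen V₁ ∧ V₁.Nonempty) ∧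
        ∀ t ∈ V₀, ∀ a ∈ V₁, (Fin.cons t a : Fin (n + 1) → F) ∈ V := by
    obtain ⟨u, hu, hsub⟩ := exists_box hV.1 hV.2
    refine ⟨u 0, Set.pi Set.univ fun i : Fin n ↦ u i.succ, hu 0,
      ⟨isOpen_set_pi Set.finite_univ fun i _ ↦ (hu _).1,
        Set.univ_pi_nonempty_iff.mpr fun i ↦ (hu _).2⟩, fun t ht a ha ↦ hsub fun i _ ↦ ?_⟩
    cases i using Fin.cases with
    | zero => exact ht
    | succ i => exact ha i (Set.mem_univ i)
  have h1 (v : InfinitePlace k) : ∃ (V₀ : Set v.Completion) (V₁ : Set (Fin n → v.Completion)),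
      Sum.inl v ∉ S → (IsOpen V₀ ∧ V₀.Nonempty) ∧ (IsOpen V₁ ∧ V₁.Nonempty) ∧
        ∀ t ∈ V₀, ∀ a ∈ V₁, (Fin.cons t a : Fin (n + 1) → v.Completion) ∈ W v := by
    by_cases hv : Sum.inl v ∉ S
    · obtain ⟨V₀, V₁, h⟩ := hbox _ _ (hW v hv)
      exact ⟨V₀, V₁, fun _ ↦ h⟩
    · exact ⟨∅, ∅, fun h ↦ absurd h hv⟩
  have h2 (v : HeightOneSpectrum (𝓞 k)) : ∃ (V₀ : Set (v.adicCompletion k))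
      (V₁ : Set (Fin n → v.adicCompletion k)), v ∈ T →
      Sum.inr v ∉ S → (IsOpen V₀ ∧ V₀.Nonempty) ∧ (IsOpen V₁ ∧ V₁.Nonempty) ∧
        ∀ t ∈ V₀, ∀ a ∈ V₁, (Fin.cons t a : Fin (n + 1) → v.adicCompletion k) ∈ W' v := by
    by_cases hv : v ∈ T ∧ Sum.inr v ∉ S
    · obtain ⟨V₀, V₁, h⟩ := hbox _ _ (hW' v hv.1 hv.2)
      exact ⟨V₀, V₁, fun _ _ ↦ h⟩
    · exact ⟨∅, ∅, fun h h' ↦ absurd ⟨h, h'⟩ hv⟩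
  choose V₀ V₁ hV using h1
  choose V₀' V₁' hV' using h2
  -- the last `n` coordinates, with an auxiliary place `v₁` at which `r` is forced not to vanish
  obtain ⟨v₁, hv₁⟩ := exists_place_notMem
    (T ∪ S.preimage Sum.inr (Sum.inr_injective.injOn))
  simp only [Finset.mem_union, Finset.mem_preimage, not_or] at hv₁
  obtain ⟨a, ha, ha', haT⟩ := exists_mem_of_isOpen_pi S hS (insert v₁ T) V₁
    (fun v ↦ if v ∈ T then V₁' v else {x | (∀ i, Valued.v (x i) ≤ 1) ∧ aeval x r ≠ 0})
    (fun v hv ↦ (hV v hv).2.1) (fun v hv hvS ↦ by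
      by_cases hvT : v ∈ T
      · simp only [if_pos hvT]
        exact (hV' v hvT hvS).2.1
      · simp only [if_neg hvT]
        have hopen : IsOpen {x : Fin n → v.adicCompletion k | ∀ i, Valued.v (x i) ≤ 1} := by
          simp only [Set.ofPred_forall]
          exact isOpen_iInter_of_finite fun i ↦
            (isOpen_setOf_valued_le_one v).preimage
              (continuous_apply (A := fun _ : Fin n ↦ v.adicCompletion k) i)
        refine ⟨hopen.inter (isOpen_ne.preimage (continuous_aeval r)), ?_⟩
        · obtain ⟨m, hm⟩ := exists_natCast_eval_ne_zero hr
          refine ⟨fun i ↦ algebraMap k _ (m i : k), fun i ↦ ?_, ?_⟩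
          · rw [valued_algebraMap]
            simpa using v.valuation_le_one (K := k) (m i : 𝓞 k)
          · rw [eval_algebraMap_comp]
            simpa using hm)
  have hint (v) (hv : v ∉ T) (hvS : Sum.inr v ∉ S) (i : Fin n) : v.valuation k (a i) ≤ 1 := by
    by_cases h : v = v₁
    · subst h
      have := ha' v (Finset.mem_insert_self _ _) hvS
      rw [if_neg hv] at this
      simpa only [valued_algebraMap] using this.1 i
    · exact haT v (by simp [h, hv]) hvS i
  have hra : eval a r ≠ 0 := by
    have := ha' v₁ (Finset.mem_insert_self _ _) hv₁.2
    rw [if_neg hv₁.1] at this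
    have h := this.2
    rw [eval_algebraMap_comp] at h
    exact fun h0 ↦ h (by rw [h0, map_zero])
  -- the first coordinate
  let p : Polynomial k := (MvPolynomial.finSuccEquiv k n f).map (eval a)
  have hp : p.Monic := hf.map _
  have hpd : p.natDegree = d := hf.natDegree_map _
  -- Outside `T`, the places with `r(a)` not of valuation `1` get the condition that `f(t, a)` is
  -- not divisible. It is open, and satisfied by a natural number because `T` contains the divisors
  -- of `d!`.
  obtain ⟨t, ht, ht', htT⟩ := exists_mem_of_isOpen S hS
    (T ∪ (finite_setOf_valuation_ne_one hra).toFinset) V₀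
    (fun v ↦ if v ∈ T then V₀' v else {x | Valued.v x ≤ 1 ∧ 1 ≤ Valued.v (Polynomial.aeval x p)})
    (fun v hv ↦ (hV v hv).1) (fun v hv hvS ↦ by
      by_cases hvT : v ∈ T
      · simp only [if_pos hvT]
        exact (hV' v hvT hvS).1
      · simp only [if_neg hvT]
        refine ⟨(isOpen_setOf_valued_le_one v).inter
          ((isOpen_setOf_one_le_valued v).preimage p.continuous_aeval), ?_⟩
        obtain ⟨i, hi⟩ := exists_nat_one_le_valuation_eval v hp (by
          rw [hpd]
          by_contra h
          exact hvT (hT ((finite_setOf_valuation_ne_one hd0).mem_toFinset.mpr h)))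
        refine ⟨algebraMap k _ (i : k), ?_, ?_⟩
        · rw [valued_algebraMap]
          simpa using v.valuation_le_one (K := k) (i : 𝓞 k)
        · rw [Polynomial.aeval_algebraMap_apply, valued_algebraMap]
          simpa using hi)
  have hf_eval : eval (Fin.cons t a : Fin (n + 1) → k) f = p.eval t := eval_eq_eval_mv_eval' _ _ _
  have hr_eval : eval (Fin.cons t a : Fin (n + 1) → k) (rename Fin.succ r) = eval a r := by
    rw [eval_rename]
    rfl
  have hcons (F : Type u) [CommRing F] [Algebra k F] :
      (fun i ↦ algebraMap k F ((Fin.cons t a : Fin (n + 1) → k) i)) =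
        Fin.cons (algebraMap k F t) fun i ↦ algebraMap k F (a i) := by
    ext i
    cases i using Fin.cases <;> rfl
  refine ⟨Fin.cons t a, fun v hv ↦ ?_, fun v hvT hv ↦ ?_, fun v hvT hv ↦ ?_, Or.inr ?_⟩
  · rw [hcons]
    exact (hV v hv).2.2 _ (ht v hv) _ (ha v hv)
  · rw [hcons]
    have e1 := ht' v (Finset.mem_union_left _ hvT) hv
    have e2 := ha' v (Finset.mem_insert_of_mem hvT) hv
    rw [if_pos hvT] at e1 e2
    exact (hV' v hvT hv).2.2 _ e1 _ e2
  · rw [hf_eval, hr_eval]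
    by_cases hvr : v.valuation k (eval a r) = 1
    · have e1 : v.valuation k t ≤ 1 := htT v (by simp [hvT, hvr]) hv
      refine ⟨fun i ↦ ?_, Or.inr hvr.ge⟩
      cases i using Fin.cases with
      | zero => exact e1
      | succ i => exact hint v hvT hv i
    · have e1 := ht' v (Finset.mem_union_right _ (by simpa using hvr)) hv
      rw [if_neg hvT, Set.mem_ofPred_eq, valued_algebraMap, Polynomial.aeval_algebraMap_apply,
        valued_algebraMap] at e1
      refine ⟨fun i ↦ ?_, Or.inl (by simpa using e1.2)⟩
      cases i using Fin.cases with
      | zero => exact e1.1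
      | succ i => exact hint v hvT hv i
  · rwa [hr_eval]

lemma approximablePair_zero (S : Finset (Place k)) (hS : S.Nonempty) :
    ApproximablePair S (1 : MvPolynomial (Fin 0) k) 1 := by
  refine ⟨∅, fun T _ W W' hW hW' ↦ ?_⟩
  obtain ⟨y, h1, h2, h3⟩ := exists_mem_of_isOpen_pi S hS T W W' hW hW'
  exact ⟨y, h1, h2, fun v hv hvS ↦ ⟨h3 v hv hvS, by simp⟩, by simp⟩

end AffineSpace

/-! ### Points of open subschemes of affine spaces in coordinates -/

section Coordinates

open MvPolynomial

variable {k : Type u} [Field k] {n : ℕ} {X : Over (Spec (.of k))}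

/-- The homomorphism `k[x₁, …, xₙ] → F` given by a point of `Fⁿ`. -/
def evalHom {F : Type u} [CommRing F] [Algebra k F] (y : Fin n → F) :
    CommRingCat.of (MvPolynomial (Fin n) k) ⟶ CommRingCat.of F :=
  CommRingCat.ofHom (aeval y).toRingHom

/-- The coordinates of an `F`-point of a scheme over affine space. -/
def coord (j : X.left ⟶ Spec (.of (MvPolynomial (Fin n) k))) {F : Type u} [CommRing F]
    [Algebra k F] (x : Points X F) (i : Fin n) : F :=
  (Spec.preimage (x.1 ≫ j)).hom (MvPolynomial.X i)

variable (j : X.left ⟶ Spec (.of (MvPolynomial (Fin n) k)))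
  (hj : j ≫ Spec.map (CommRingCat.ofHom (algebraMap k _)) = X.hom)

include hj in
lemma comp_eq_evalHom {F : Type u} [CommRing F] [Algebra k F] (x : Points X F) :
    x.1 ≫ j = Spec.map (evalHom (coord j x)) := by
  rw [← Spec.map_preimage (x.1 ≫ j)]
  congr 1
  have h1 : CommRingCat.ofHom (algebraMap k (MvPolynomial (Fin n) k)) ≫ Spec.preimage (x.1 ≫ j) =
      CommRingCat.ofHom (algebraMap k F) := by
    apply Spec.map_injective
    rw [Spec.map_comp, Spec.map_preimage, Category.assoc, hj, x.2]
  ext p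
  · have := congrArg (fun f ↦ f.hom p) h1
    simpa [evalHom] using! this
  · simp [evalHom, coord]

include hj in
lemma coord_eq_of_comp_eq {F : Type u} [CommRing F] [Algebra k F] (x : Points X F) (y : Fin n → F)
    (h : x.1 ≫ j = Spec.map (evalHom y)) : coord j x = y := by
  rw [comp_eq_evalHom j hj] at h
  have h1 := Spec.map_injective h
  ext i
  simpa [evalHom] using congrArg (fun f ↦ f.hom (MvPolynomial.X i)) h1

include hj in
lemma coord_baseChange (x : Points X k) (F : Type u) [CommRing F] [Algebra k F] :
    coord j (x.baseChange F) = fun i ↦ algebraMap k F (coord j x i) := by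
  apply coord_eq_of_comp_eq j hj
  rw [Points.baseChange, Category.assoc, comp_eq_evalHom j hj, ← Spec.map_comp]
  congr 1
  ext p <;> simp [evalHom]

section Away

variable {F : Type u} [Field F] [Algebra k F]

/-- The homomorphism `k[x₁, …, xₙ][1 / h] → F` given by a point of `Fⁿ` at which `h` does not
vanish. -/
def awayHom {h : MvPolynomial (Fin n) k} {y : Fin n → F} (hy : aeval y h ≠ 0) :
    CommRingCat.of (Localization.Away h) ⟶ CommRingCat.of F :=
  CommRingCat.ofHom (IsLocalization.Away.lift (S := Localization.Away h) h
    (g := (aeval y).toRingHom) (IsUnit.mk0 _ hy))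

lemma awayHom_algebraMap {h : MvPolynomial (Fin n) k} {y : Fin n → F} (hy : aeval y h ≠ 0)
    (r : MvPolynomial (Fin n) k) :
    (awayHom hy).hom (algebraMap _ (Localization.Away h) r) = aeval y r :=
  IsLocalization.Away.lift_eq h (g := (aeval y).toRingHom) (IsUnit.mk0 _ hy) r

lemma algebraMap_comp_awayHom {h : MvPolynomial (Fin n) k} {y : Fin n → F} (hy : aeval y h ≠ 0) :
    CommRingCat.ofHom (algebraMap (MvPolynomial (Fin n) k) (Localization.Away h)) ≫ awayHom hy =
      evalHom y :=
  CommRingCat.hom_ext <| RingHom.ext fun r ↦ awayHom_algebraMap hy r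

lemma exists_chart [IsOpenImmersion j] (h : MvPolynomial (Fin n) k)
    (hh : (PrimeSpectrum.basicOpen h : Set (PrimeSpectrum (MvPolynomial (Fin n) k))) ⊆
      Set.range j) :
    ∃ c : Spec (.of (Localization.Away h)) ⟶ X.left,
      c ≫ j = Spec.map (CommRingCat.ofHom (algebraMap _ (Localization.Away h))) := by
  refine ⟨IsOpenImmersion.lift j (Spec.map (CommRingCat.ofHom (algebraMap _ _))) ?_,
    IsOpenImmersion.lift_fac _ _ _⟩
  refine subset_trans (Eq.subset ?_) hh
  exact PrimeSpectrum.localization_away_comap_range (Localization.Away h) h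

variable {j} in
lemma eq_awayHom_comp_chart [IsOpenImmersion j] {h : MvPolynomial (Fin n) k}
    {c : Spec (.of (Localization.Away h)) ⟶ X.left}
    (hc : c ≫ j = Spec.map (CommRingCat.ofHom (algebraMap _ (Localization.Away h))))
    (x : Spec (.of F) ⟶ X.left) {y : Fin n → F} (hx : x ≫ j = Spec.map (evalHom y))
    (hy : aeval y h ≠ 0) : x = Spec.map (awayHom hy) ≫ c := by
  rw [← cancel_mono j, hx, Category.assoc, hc, ← Spec.map_comp, algebraMap_comp_awayHom]

include hj in
lemma exists_point [IsOpenImmersion j] (h : MvPolynomial (Fin n) k)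
    (hh : (PrimeSpectrum.basicOpen h : Set (PrimeSpectrum (MvPolynomial (Fin n) k))) ⊆
      Set.range j) (y : Fin n → F) (hy : aeval y h ≠ 0) :
    ∃ x : Points X F, coord j x = y := by
  obtain ⟨c, hc⟩ := exists_chart j h hh
  have h1 : (Spec.map (awayHom hy) ≫ c) ≫ j = Spec.map (evalHom y) := by
    rw [Category.assoc, hc, ← Spec.map_comp, algebraMap_comp_awayHom]
  refine ⟨⟨Spec.map (awayHom hy) ≫ c, ?_⟩, coord_eq_of_comp_eq j hj _ _ h1⟩
  rw [← hj, ← Category.assoc, h1, ← Spec.map_comp]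
  congr 1
  ext a
  simp [evalHom]

/-- Around each point of `X`, a morphism to a scheme is given by a homomorphism of rings from the
coordinate ring of an affine open subset to a localization of the polynomial ring. -/
lemma exists_chart_map [IsOpenImmersion j] {Y : Scheme.{u}} (g : X.left ⟶ Y) {W : Y.Opens}
    (hW : IsAffineOpen W) (p : X.left) (hp : g p ∈ W) :
    ∃ (h : MvPolynomial (Fin n) k) (c : Spec (.of (Localization.Away h)) ⟶ X.left)
      (θ : Γ(Y, W) ⟶ .of (Localization.Away h)),
      j p ∈ PrimeSpectrum.basicOpen h ∧
      (PrimeSpectrum.basicOpen h : Set (PrimeSpectrum (MvPolynomial (Fin n) k))) ⊆ Set.range j ∧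
      c ≫ j = Spec.map (CommRingCat.ofHom (algebraMap _ (Localization.Away h))) ∧
      Spec.map θ ≫ hW.fromSpec = c ≫ g := by
  have hopen : IsOpen (j '' (g ⁻¹' W)) :=
    j.isOpenEmbedding.isOpenMap _ (W.2.preimage g.continuous)
  obtain ⟨_, ⟨h, rfl⟩, hph, hsub⟩ :=
    PrimeSpectrum.isTopologicalBasis_basic_opens.exists_subset_of_mem_open
      (Set.mem_image_of_mem j hp) hopen
  have hh := hsub.trans (Set.image_subset_range _ _)
  obtain ⟨c, hc⟩ := exists_chart j h hh
  have hrange : Set.range (c ≫ g) ⊆ Set.range hW.fromSpec := by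
    rw [hW.range_fromSpec]
    rintro _ ⟨q, rfl⟩
    have h1 : j (c q) ∈ (PrimeSpectrum.basicOpen h : Set (PrimeSpectrum _)) := by
      rw [← PrimeSpectrum.localization_away_comap_range (Localization.Away h) h]
      refine ⟨q, ?_⟩
      rw [← Scheme.Hom.comp_apply, hc]
      rfl
    obtain ⟨q', hq', he⟩ := hsub h1
    have := j.isOpenEmbedding.injective he
    rw [Scheme.Hom.comp_apply, ← this]
    exact hq'
  refine ⟨h, c, Spec.preimage (IsOpenImmersion.lift hW.fromSpec (c ≫ g) hrange), hph, hh, hc, ?_⟩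
  rw [Spec.map_preimage, IsOpenImmersion.lift_fac]

lemma aeval_ne_zero_of_mem {x : Spec (.of F) ⟶ X.left} {y : Fin n → F}
    (hx : x ≫ j = Spec.map (evalHom y)) {h : MvPolynomial (Fin n) k} (p : Spec (.of F))
    (hp : j (x p) ∈ PrimeSpectrum.basicOpen h) : aeval y h ≠ 0 := by
  intro h0
  rw [← Scheme.Hom.comp_apply, hx] at hp
  refine hp ?_
  change aeval y h ∈ p.asIdeal
  rw [h0]
  exact zero_mem _

/-- The topology on `X(F)` is coarser than the topology given by the coordinates. -/
lemma exists_isOpen_coord [TopologicalSpace F] [IsTopologicalRing F] [ContinuousInv₀ F] [T1Space F]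
    [IsOpenImmersion j] (hj : j ≫ Spec.map (CommRingCat.ofHom (algebraMap k _)) = X.hom)
    {O : Set (Points X F)} (hO : IsOpen O) :
    ∃ W : Set (Fin n → F), IsOpen W ∧ O = coord j ⁻¹' W := by
  suffices h : TopologicalSpace.induced (coord j (F := F)) inferInstance ≤ Points.topology X F by
    obtain ⟨W, hW, h1⟩ := isOpen_induced_iff.mp (h O hO)
    exact ⟨W, hW, h1.symm⟩
  refine le_generateFrom ?_
  rintro _ ⟨V, hV, f, O, hO, rfl⟩
  refine (@isOpen_iff_mem_nhds _ (TopologicalSpace.induced (coord j (F := F))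
    inferInstance) _).mpr fun x hx ↦ ?_
  obtain ⟨φ, hφ, hφO⟩ := hx
  let p : Spec (.of F) := (⊥ : PrimeSpectrum F)
  have hpV : x.1 p ∈ V := by
    rw [← hφ, Scheme.Hom.comp_apply]
    have : hV.fromSpec (Spec.map φ p) ∈ Set.range hV.fromSpec := ⟨_, rfl⟩
    rwa [hV.range_fromSpec] at this
  obtain ⟨h, c, θ, hph, hh, hc, hθ⟩ := exists_chart_map j (𝟙 X.left) hV (x.1 p) (by simpa using hpV)
  rw [Category.comp_id] at hθ
  -- On the chart where `h` does not vanish, the regular function `f` is `r / h ^ N`, which is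
  -- continuous in the coordinates.
  obtain ⟨⟨r, s⟩, hrs⟩ := IsLocalization.surj (Submonoid.powers h) (θ.hom f)
  obtain ⟨N, hN⟩ := s.2
  have hxh : aeval (coord j x) h ≠ 0 := aeval_ne_zero_of_mem j (comp_eq_evalHom j hj x) p hph
  have hval (z : Points X F) (hz : aeval (coord j z) h ≠ 0) :
      (awayHom hz).hom (θ.hom f) = aeval (coord j z) r / aeval (coord j z) h ^ N := by
    have h1 := congrArg (awayHom hz).hom hrs
    rw [map_mul, awayHom_algebraMap, awayHom_algebraMap] at h1
    rw [eq_div_iff (pow_ne_zero _ hz), ← map_pow]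
    simpa only [hN] using h1
  have hfac (z : Points X F) (hz : aeval (coord j z) h ≠ 0) :
      Spec.map (θ ≫ awayHom hz) ≫ hV.fromSpec = z.1 := by
    rw [eq_awayHom_comp_chart hc z.1 (comp_eq_evalHom j hj z) hz, Spec.map_comp, Category.assoc, hθ]
  have hopen : IsOpen ({y : Fin n → F | aeval y h ≠ 0} ∩
      (fun y ↦ aeval y r / aeval y h ^ N) ⁻¹' O) := by
    refine ContinuousOn.isOpen_inter_preimage ?_ (isOpen_ne.preimage (continuous_aeval h)) hO
    exact (continuous_aeval r).continuousOn.div ((continuous_aeval h).pow N).continuousOn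
      fun y hy ↦ pow_ne_zero _ hy
  rw [nhds_induced]
  refine ⟨_, hopen.mem_nhds ⟨hxh, ?_⟩, fun z hz ↦ ⟨θ ≫ awayHom hz.1, hfac z hz.1, ?_⟩⟩
  · have h1 : φ = θ ≫ awayHom hxh := by
      apply Spec.map_injective
      rw [← cancel_mono hV.fromSpec, hφ, hfac]
    rw [h1] at hφO
    rw [Set.mem_preimage, ← hval x hxh]
    exact hφO
  · have := hz.2
    rw [Set.mem_preimage, ← hval z hz.1] at this
    exact this

end Away

end Coordinates

/-! ### Integral points of models -/

section Models

open MvPolynomial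

variable {k : Type u} [Field k] [NumberField k] {n : ℕ} {X : Over (Spec (.of k))}

/-- The `O_k`-algebra structure of the coordinate ring of an affine open subscheme of a model. -/
def IntegralModel.baseHom (M : IntegralModel X) {W : M.scheme.Opens} (hW : IsAffineOpen W) :
    CommRingCat.of (𝓞 k) ⟶ Γ(M.scheme, W) :=
  Spec.preimage (hW.fromSpec ≫ M.toBase)

omit [NumberField k] in
lemma IntegralModel.exists_generators (M : IntegralModel X) {W : M.scheme.Opens}
    (hW : IsAffineOpen W) : ∃ G : Finset Γ(M.scheme, W), ∀ R : Subring Γ(M.scheme, W),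
      (∀ a, (M.baseHom hW).hom a ∈ R) → (∀ b ∈ G, b ∈ R) → R = ⊤ := by
  have h1 : (M.baseHom hW).hom.FiniteType := by
    have := M.locallyOfFiniteType
    rw [← HasRingHomProperty.Spec_iff (P := @LocallyOfFiniteType), IntegralModel.baseHom,
      Spec.map_preimage]
    infer_instance
  algebraize [(M.baseHom hW).hom]
  obtain ⟨G, hG⟩ := Algebra.FiniteType.out (R := 𝓞 k) (A := Γ(M.scheme, W))
  refine ⟨G, fun R hR hGR ↦ ?_⟩
  let R' : Subalgebra (𝓞 k) Γ(M.scheme, W) := { R with algebraMap_mem' := hR }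
  have h2 : R' = ⊤ := by
    rw [← top_le_iff, ← hG]
    exact Algebra.adjoin_le hGR
  rw [← top_le_iff]
  intro x _
  exact (h2 ▸ Algebra.mem_top : x ∈ R')

/-- The preimage of `O_v` under `φ` is a subring containing the image of `O_k` and the generators,
hence everything; so `φ` factors through `O_v`. -/
lemma IntegralModel.mem_integralPoints_of_generators (M : IntegralModel X) {W : M.scheme.Opens}
    (hW : IsAffineOpen W) (G : Finset Γ(M.scheme, W)) (hG : ∀ R : Subring Γ(M.scheme, W),
      (∀ a, (M.baseHom hW).hom a ∈ R) → (∀ b ∈ G, b ∈ R) → R = ⊤)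
    (v : HeightOneSpectrum (𝓞 k)) (x : Points X (v.adicCompletion k))
    (φ : Γ(M.scheme, W) ⟶ .of (v.adicCompletion k))
    (hφ : Spec.map φ ≫ hW.fromSpec = x.1 ≫ M.generic) (hφG : ∀ b ∈ G, Valued.v (φ.hom b) ≤ 1) :
    x ∈ M.integralPoints v := by
  have hbase : M.baseHom hW ≫ φ =
      CommRingCat.ofHom (algebraMap (𝓞 k) (v.adicCompletion k)) := by
    apply Spec.map_injective
    rw [Spec.map_comp, IntegralModel.baseHom, Spec.map_preimage, ← Category.assoc, hφ,
      Category.assoc, M.isPullback.w, ← Category.assoc, x.2, ← Spec.map_comp,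
      ← CommRingCat.ofHom_comp, ← IsScalarTower.algebraMap_eq]
  have hmem (b : Γ(M.scheme, W)) : φ.hom b ∈ (v.adicCompletionIntegers k).toSubring := by
    have h1 := hG ((v.adicCompletionIntegers k).toSubring.comap φ.hom) (fun a ↦ ?_) hφG
    · have : b ∈ (⊤ : Subring Γ(M.scheme, W)) := Subring.mem_top b
      rwa [← h1] at this
    · have h2 : φ.hom ((M.baseHom hW).hom a) = algebraMap (𝓞 k) (v.adicCompletion k) a :=
        congrArg (fun f ↦ f.hom a) hbase
      rw [Subring.mem_comap, h2]
      exact v.coe_mem_adicCompletionIntegers (K := k) a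
  let ψ : Γ(M.scheme, W) ⟶ .of (v.adicCompletionIntegers k) :=
    CommRingCat.ofHom (φ.hom.codRestrict (v.adicCompletionIntegers k).toSubring hmem)
  have hψ : ψ ≫ CommRingCat.ofHom
      (algebraMap (v.adicCompletionIntegers k) (v.adicCompletion k)) = φ := by
    ext b
    rfl
  refine ⟨Spec.map ψ ≫ hW.fromSpec, ?_, ?_⟩
  · have h1 : M.baseHom hW ≫ ψ =
        CommRingCat.ofHom (algebraMap (𝓞 k) (v.adicCompletionIntegers k)) := by
      ext a
      have h2 : φ.hom ((M.baseHom hW).hom a) = algebraMap (𝓞 k) (v.adicCompletion k) a :=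
        congrArg (fun f ↦ f.hom a) hbase
      exact congrArg _ h2
    rw [← h1, Spec.map_comp, IntegralModel.baseHom, Spec.map_preimage, Category.assoc]
  · rw [← Category.assoc, ← Spec.map_comp, hψ, hφ]

/-- Every point of the spectrum of a local ring specializes to the closed point, so an open set
containing the image of the latter contains the whole image. -/
lemma exists_eq_Spec_map_of_closedPoint {A : Type u} [CommRing A] [IsLocalRing A] {Y : Scheme.{u}}
    (y : Spec (.of A) ⟶ Y) {W : Y.Opens} (hW : IsAffineOpen W)
    (hy : y (IsLocalRing.closedPoint A) ∈ W) :
    ∃ ψ : Γ(Y, W) ⟶ .of A, Spec.map ψ ≫ hW.fromSpec = y := by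
  have hrange : Set.range y ⊆ Set.range hW.fromSpec := by
    rw [hW.range_fromSpec]
    rintro _ ⟨p, rfl⟩
    exact ((IsLocalRing.specializes_closedPoint p).map y.continuous).mem_open W.2 hy
  exact ⟨Spec.preimage (IsOpenImmersion.lift hW.fromSpec y hrange), by
    rw [Spec.map_preimage, IsOpenImmersion.lift_fac]⟩

/-- The integral points form an open subset. -/
lemma IntegralModel.isOpen_integralPoints (M : IntegralModel X) (v : HeightOneSpectrum (𝓞 k)) :
    IsOpen (M.integralPoints v) := by
  rw [isOpen_iff_forall_mem_open]
  rintro x ⟨y, hy, hyx⟩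
  obtain ⟨W, hW, hyW, -⟩ := exists_isAffineOpen_mem_and_subset (U := ⊤)
    (x := y (IsLocalRing.closedPoint _)) trivial
  obtain ⟨ψ, hψ⟩ := exists_eq_Spec_map_of_closedPoint y hW hyW
  obtain ⟨G, hG⟩ := M.exists_generators hW
  let ι := CommRingCat.ofHom (algebraMap (v.adicCompletionIntegers k) (v.adicCompletion k))
  have hx : Spec.map (ψ ≫ ι) ≫ hW.fromSpec = x.1 ≫ M.generic := by
    rw [Spec.map_comp, Category.assoc, hψ]
    exact hyx
  let p : Spec (.of (v.adicCompletion k)) := IsLocalRing.closedPoint (v.adicCompletion k)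
  have hp : x.1 p ∈ M.generic ⁻¹ᵁ W := by
    change M.generic (x.1 p) ∈ W
    rw [← Scheme.Hom.comp_apply, ← hx, Scheme.Hom.comp_apply]
    have : hW.fromSpec (Spec.map (ψ ≫ ι) p) ∈ Set.range hW.fromSpec := ⟨_, rfl⟩
    rwa [hW.range_fromSpec] at this
  obtain ⟨V, hV, hpV, hVW⟩ := exists_isAffineOpen_mem_and_subset hp
  let res := M.generic.appLE W V hVW
  have hres (z : Points X (v.adicCompletion k)) (φ : Γ(X.left, V) ⟶ .of (v.adicCompletion k))
      (hφ : Spec.map φ ≫ hV.fromSpec = z.1) :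
      Spec.map (res ≫ φ) ≫ hW.fromSpec = z.1 ≫ M.generic := by
    have h : Spec.map res ≫ hW.fromSpec = hV.fromSpec ≫ M.generic :=
      IsAffineOpen.SpecMap_appLE_fromSpec _ hW hV _
    rw [Spec.map_comp, Category.assoc, h, ← Category.assoc, hφ]
  obtain ⟨φ, hφ⟩ := exists_eq_Spec_map_of_closedPoint x.1 hV hpV
  let O : Set (v.adicCompletion k) := {a | Valued.v a ≤ 1}
  have hO : IsOpen O := isOpen_setOf_valued_le_one v
  -- The first set is all of `V(k_v)`; the others ask that the finitely many generators take
  -- integral values.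
  refine ⟨Points.evalIn hV 1 Set.univ ∩ ⋂ b ∈ G, Points.evalIn hV (res.hom b) O, ?_,
    IsOpen.inter ?_ ?_, ?_, ?_⟩
  · rintro z ⟨⟨φ', hφ', -⟩, hz⟩
    refine M.mem_integralPoints_of_generators hW G hG v z (res ≫ φ') (hres z φ' hφ') fun b hb ↦ ?_
    obtain ⟨φ'', hφ'', h⟩ := Set.mem_iInter₂.mp hz b hb
    have : φ'' = φ' := by
      apply Spec.map_injective
      rw [← cancel_mono hV.fromSpec, hφ', hφ'']
    rw [this] at h
    exact h
  · exact TopologicalSpace.isOpen_generateFrom_of_mem ⟨V, hV, _, _, isOpen_univ, rfl⟩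
  · exact isOpen_biInter_finset fun b _ ↦
      TopologicalSpace.isOpen_generateFrom_of_mem ⟨V, hV, _, _, hO, rfl⟩
  · exact ⟨φ, hφ, trivial⟩
  · refine Set.mem_iInter₂.mpr fun b _ ↦ ⟨φ, hφ, ?_⟩
    have h1 : res ≫ φ = ψ ≫ ι := by
      apply Spec.map_injective
      rw [← cancel_mono hW.fromSpec, hres x φ hφ, hx]
    have h2 : φ.hom (res.hom b) = ι.hom (ψ.hom b) := congrArg (fun f ↦ f.hom b) h1
    rw [h2]
    exact (ψ.hom b).2

lemma exists_finset_valued_aeval_le_one (p : MvPolynomial (Fin n) k) :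
    ∃ B : Finset (HeightOneSpectrum (𝓞 k)), ∀ v ∉ B, ∀ y : Fin n → v.adicCompletion k,
      (∀ i, Valued.v (y i) ≤ 1) → Valued.v (aeval y p) ≤ 1 := by
  classical
  refine ⟨p.support.biUnion fun m ↦ (finite_setOf_one_lt_valuation (p.coeff m)).toFinset,
    fun v hv y hy ↦ ?_⟩
  rw [aeval_def, eval₂_eq']
  refine Valuation.map_sum_le _ fun m hm ↦ ?_
  rw [map_mul, map_prod]
  refine mul_le_one' ?_ (Finset.prod_le_one' fun i _ ↦ ?_)
  · rw [valued_algebraMap]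
    by_contra! h
    exact hv (Finset.mem_biUnion.mpr ⟨m, hm, (Set.Finite.mem_toFinset _).mpr h⟩)
  · rw [map_pow]
    exact pow_le_one' (hy i) _

variable (j : X.left ⟶ Spec (.of (MvPolynomial (Fin n) k))) [IsOpenImmersion j]
  (hj : j ≫ Spec.map (CommRingCat.ofHom (algebraMap k _)) = X.hom)

include hj in
-- Near `q`, each generator of an affine chart of the model is a fraction `r / h ^ N`. Its value is
-- integral once the coefficients of `r` and the coordinates are integral and `h` is not divisible
-- by `v`.
lemma IntegralModel.exists_finset_mem_integralPoints_of_mem (M : IntegralModel X) (q : X.left) :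
    ∃ h : MvPolynomial (Fin n) k, j q ∈ PrimeSpectrum.basicOpen h ∧
      ∃ B : Finset (HeightOneSpectrum (𝓞 k)), ∀ v ∉ B, ∀ x : Points X (v.adicCompletion k),
        (∀ i, Valued.v (coord j x i) ≤ 1) → 1 ≤ Valued.v (aeval (coord j x) h) →
          x ∈ M.integralPoints v := by
  classical
  obtain ⟨W, hW, hqW, -⟩ := exists_isAffineOpen_mem_and_subset (U := ⊤) (x := M.generic q) trivial
  obtain ⟨h, c, θ, hqh, -, hc, hθ⟩ := exists_chart_map j M.generic hW q hqW
  obtain ⟨G, hG⟩ := M.exists_generators hW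
  have hfrac (b : Γ(M.scheme, W)) : ∃ (r : MvPolynomial (Fin n) k) (N : ℕ),
      θ.hom b * algebraMap _ (Localization.Away h) (h ^ N) = algebraMap _ _ r := by
    obtain ⟨⟨r, ⟨_, N, rfl⟩⟩, hrs⟩ := IsLocalization.surj (Submonoid.powers h) (θ.hom b)
    exact ⟨r, N, hrs⟩
  choose r N hrN using hfrac
  choose B hB using fun b : Γ(M.scheme, W) ↦ exists_finset_valued_aeval_le_one (r b)
  refine ⟨h, hqh, G.biUnion B, fun v hv x hx hxh ↦ ?_⟩
  have hy : aeval (coord j x) h ≠ 0 := by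
    intro h0
    rw [h0, map_zero] at hxh
    simp at hxh
  refine M.mem_integralPoints_of_generators hW G hG v x (θ ≫ awayHom hy) ?_ fun b hb ↦ ?_
  · rw [Spec.map_comp, Category.assoc, hθ,
      eq_awayHom_comp_chart hc x.1 (comp_eq_evalHom j hj x) hy, Category.assoc]
  · have h1 := congrArg (awayHom hy).hom (hrN b)
    rw [map_mul, awayHom_algebraMap, awayHom_algebraMap, map_pow] at h1
    have h2 := congrArg Valued.v h1
    rw [map_mul, map_pow] at h2
    have h3 : Valued.v (aeval (coord j x) (r b)) ≤ 1 :=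
      hB b v (fun hvb ↦ hv (Finset.mem_biUnion.mpr ⟨b, hb, hvb⟩)) _ hx
    rw [← h2] at h3
    exact (le_mul_of_one_le_right' (one_le_pow_of_one_le' hxh _)).trans h3

include hj in
/-- A point with integral coordinates at which `f` is not divisible by `v` is an integral point of
the model, for all but finitely many `v`. -/
lemma IntegralModel.exists_finset_mem_integralPoints (M : IntegralModel X)
    (f : MvPolynomial (Fin n) k)
    (hf : (PrimeSpectrum.basicOpen f : Set (PrimeSpectrum (MvPolynomial (Fin n) k))) ⊆
      Set.range j) :
    ∃ B : Finset (HeightOneSpectrum (𝓞 k)), ∀ v ∉ B, ∀ x : Points X (v.adicCompletion k),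
      (∀ i, Valued.v (coord j x i) ≤ 1) → 1 ≤ Valued.v (aeval (coord j x) f) →
        x ∈ M.integralPoints v := by
  classical
  choose h hh B hB using M.exists_finset_mem_integralPoints_of_mem j hj
  -- The sets `h q ≠ 0` cover the locus `f ≠ 0`, so a power of `f` is a finite combination of the `h
  -- q`. At almost all `v`, if all the `h q` involved were divisible by `v`, so would be `f`.
  have hrad : f ∈ (Ideal.span (Set.range h)).radical := by
    rw [Ideal.radical_eq_sInf, Submodule.mem_sInf]
    rintro P ⟨hP, hPp⟩
    by_contra hfP
    obtain ⟨q, hq⟩ := hf (show (⟨P, hPp⟩ : PrimeSpectrum _) ∈ PrimeSpectrum.basicOpen f from hfP)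
    have h1 := hh q
    rw [hq] at h1
    exact h1 (hP (Ideal.subset_span ⟨q, rfl⟩))
  obtain ⟨N, hN⟩ := hrad
  obtain ⟨c, hc⟩ := Finsupp.mem_span_range_iff_exists_finsupp.mp hN
  choose B' hB' using fun q ↦ exists_finset_valued_aeval_le_one (c q)
  refine ⟨c.support.biUnion fun q ↦ B q ∪ B' q, fun v hv x hx hxf ↦ ?_⟩
  have hv' (q) (hq : q ∈ c.support) : v ∉ B q ∧ v ∉ B' q := by
    constructor <;> intro h0 <;>
    exact hv (Finset.mem_biUnion.mpr ⟨q, hq, by simp [h0]⟩)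
  by_contra hxM
  have hlt (q) (hq : q ∈ c.support) : Valued.v (aeval (coord j x) (h q)) < 1 := by
    by_contra! hle
    exact hxM (hB q v (hv' q hq).1 x hx hle)
  have h1 : Valued.v (aeval (coord j x) (f ^ N)) < 1 := by
    rw [← hc, Finsupp.sum, map_sum]
    refine Valuation.map_sum_lt _ one_ne_zero fun q hq ↦ ?_
    rw [smul_eq_mul, map_mul, map_mul]
    refine (mul_le_mul_left (hB' q v (hv' q hq).2 _ hx) _).trans_lt ?_
    rw [one_mul]
    exact hlt q hq
  rw [map_pow, map_pow] at h1
  exact h1.not_ge (one_le_pow_of_one_le' hxf _)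

attribute [local instance] algebraMvPolynomial in
omit [NumberField k] in
lemma isPullback_Spec_mvPolynomial (R S : Type u) [CommRing R] [CommRing S] [Algebra R S] (n : ℕ) :
    IsPullback
      (Spec.map (CommRingCat.ofHom
        (algebraMap (MvPolynomial (Fin n) R) (MvPolynomial (Fin n) S))))
      (Spec.map (CommRingCat.ofHom (algebraMap S (MvPolynomial (Fin n) S))))
      (Spec.map (CommRingCat.ofHom (algebraMap R (MvPolynomial (Fin n) R))))
      (Spec.map (CommRingCat.ofHom (algebraMap R S))) :=
  isPullback_SpecMap_of_isPushout _ _ _ _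
    (CommRingCat.isPushout_of_isPushout R (MvPolynomial (Fin n) R) S (MvPolynomial (Fin n) S))

attribute [local instance] algebraMvPolynomial in
include hj in
/-- Open subschemes of affine spaces have models. -/
lemma nonempty_integralModel : Nonempty (IntegralModel X) := by
  let a : Spec (.of (MvPolynomial (Fin n) k)) ⟶ Spec (.of (MvPolynomial (Fin n) (𝓞 k))) :=
    Spec.map (CommRingCat.ofHom (algebraMap _ _))
  let π : Spec (.of (MvPolynomial (Fin n) (𝓞 k))) ⟶ Spec (.of (𝓞 k)) :=
    Spec.map (CommRingCat.ofHom (algebraMap _ _))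
  have hpb : IsPullback a (Spec.map (CommRingCat.ofHom (algebraMap k (MvPolynomial (Fin n) k))))
      π (Spec.map (CommRingCat.ofHom (algebraMap (𝓞 k) k))) := by
    exact isPullback_Spec_mvPolynomial (𝓞 k) k n
  -- `k[x]` is the localization of `O_k[x]` at the nonzero constants, so its spectrum carries the
  -- induced topology and the open set extends to the integral affine space.
  obtain ⟨U₀, hU₀, hU₀j⟩ : ∃ U₀ : Set (PrimeSpectrum (MvPolynomial (Fin n) (𝓞 k))),
      IsOpen U₀ ∧ a ⁻¹' U₀ = Set.range j := by
    exact (PrimeSpectrum.localization_comap_isInducing (MvPolynomial (Fin n) k)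
      ((nonZeroDivisors (𝓞 k)).map (C (σ := Fin n)))).isOpen_iff.mp j.isOpenEmbedding.isOpen_range
  let U : (Spec (.of (MvPolynomial (Fin n) (𝓞 k)))).Opens := ⟨U₀, hU₀⟩
  have hrange : Set.range (j ≫ a) ⊆ Set.range U.ι := by
    rw [Scheme.Opens.range_ι]
    rintro _ ⟨q, rfl⟩
    rw [Scheme.Hom.comp_apply]
    exact hU₀j.ge ⟨q, rfl⟩
  have hsq : IsPullback (IsOpenImmersion.lift U.ι (j ≫ a) hrange) j U.ι a := by
    refine IsOpenImmersion.isPullback _ _ _ _ (IsOpenImmersion.lift_fac _ _ _).symm ?_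
    rw [Scheme.Opens.opensRange_ι]
    exact TopologicalSpace.Opens.ext hU₀j
  have hpb' := hsq.paste_vert hpb
  rw [hj] at hpb'
  have hfin : (algebraMap (𝓞 k) (MvPolynomial (Fin n) (𝓞 k))).FiniteType := by
    rw [RingHom.finiteType_algebraMap]
    infer_instance
  have hπ : LocallyOfFiniteType π := by
    rwa [HasRingHomProperty.Spec_iff (P := @LocallyOfFiniteType)]
  exact ⟨⟨U, U.ι ≫ π, _, inferInstance, inferInstance, hpb'⟩⟩

end Models

/-! ### Strong approximation -/

section RestrictedProduct

open Filter

/-- Neighbourhoods in a restricted product contain sets that are given by finitely many open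
conditions on the components, together with the integrality conditions that hold at the centre. -/
lemma exists_finset_of_isOpen_restrictedProduct {ι : Type*} {R : ι → Type*}
    [∀ i, TopologicalSpace (R i)] {A : ∀ i, Set (R i)} {O : Set (Πʳ i, [R i, A i])}
    (hO : IsOpen O) {a : Πʳ i, [R i, A i]} (ha : a ∈ O) :
    ∃ (J : Finset ι) (u : ∀ i, Set (R i)), (∀ i ∈ J, IsOpen (u i) ∧ a i ∈ u i) ∧
      ∀ b : ∀ i, R i, (∀ i ∈ J, b i ∈ u i) → (∀ i, a i ∈ A i → b i ∈ A i) →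
        ∃ c ∈ O, ∀ i, c i = b i := by
  -- With integrality required exactly at the indices in `E`, the restricted product carries the
  -- topology induced from the full product, where basic open sets are known.
  set E : Set ι := {i | a i ∈ A i}
  have hE : cofinite ≤ 𝓟 E := le_principal_iff.mpr a.2
  let a' : Πʳ i, [R i, A i]_[𝓟 E] := ⟨a.1, mem_principal_self E⟩
  have hO' := hO.preimage (RestrictedProduct.continuous_inclusion (R := R) (A := A) hE)
  obtain ⟨V, hV, hVO⟩ :=
    (RestrictedProduct.isEmbedding_coe_of_principal (R := R) (A := A)
      (S := E)).isInducing.isOpen_iff.mp hO'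
  have haV : (a' : ∀ i, R i) ∈ V := by
    change a' ∈ _ ⁻¹' V
    rw [hVO]
    exact ha
  obtain ⟨J, u, hu, hJ⟩ := isOpen_pi_iff.mp hV _ haV
  refine ⟨J, u, hu, fun b hb hbA ↦ ?_⟩
  let b' : Πʳ i, [R i, A i]_[𝓟 E] := ⟨b, mem_principal.mpr hbA⟩
  have hb' : b' ∈ RestrictedProduct.inclusion R A hE ⁻¹' O := by
    rw [← hVO]
    exact hJ fun i hi ↦ hb i hi
  exact ⟨_, hb', fun i ↦ rfl⟩

end RestrictedProduct

/-! ### From a pair of polynomials to density in the adelic points -/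

section Main

open MvPolynomial

variable {k : Type u} [Field k] [NumberField k] {n : ℕ} {X : Over (Spec (.of k))}
  (j : X.left ⟶ Spec (.of (MvPolynomial (Fin n) k))) [IsOpenImmersion j]
  (hj : j ≫ Spec.map (CommRingCat.ofHom (algebraMap k _)) = X.hom)

include hj in
lemma strongApproximationOff_of_approximablePair (S : Finset (Place k))
    (f g : MvPolynomial (Fin n) k)
    (hf : (PrimeSpectrum.basicOpen f : Set (PrimeSpectrum (MvPolynomial (Fin n) k))) ⊆
      Set.range j)
    (hg : (PrimeSpectrum.basicOpen g : Set (PrimeSpectrum (MvPolynomial (Fin n) k))) ⊆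
      Set.range j)
    (hfg : ApproximablePair S f g) : StrongApproximationOff X S := by
  classical
  refine ⟨nonempty_integralModel j hj, fun M ↦ ?_⟩
  rw [dense_iff_inter_open]
  rintro O hO ⟨a, ha⟩
  obtain ⟨O₁, O₂, hO₁, hO₂, ha₁, ha₂, hsub⟩ := isOpen_prod_iff.mp hO a.1 a.2 ha
  obtain ⟨u₁, hu₁, hsub₁⟩ := isOpen_pi_iff'.mp hO₁ a.1 ha₁
  obtain ⟨J, u₂, hu₂, hsub₂⟩ := exists_finset_of_isOpen_restrictedProduct hO₂ ha₂
  -- the conditions to be satisfied, in coordinates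
  have h1 (v : InfinitePlace k) : ∃ W : Set (Fin n → v.Completion), ∀ hv : Sum.inl v ∉ S,
      IsOpen W ∧ W.Nonempty ∧ ∀ x : Points X v.Completion, coord j x ∈ W → x ∈ u₁ ⟨v, hv⟩ := by
    by_cases hv : Sum.inl v ∉ S
    · obtain ⟨W, hW, hWu⟩ := exists_isOpen_coord j hj (hu₁ ⟨v, hv⟩).1
      refine ⟨W, fun _ ↦ ⟨hW, ⟨coord j (a.1 ⟨v, hv⟩), ?_⟩, fun x hx ↦ ?_⟩⟩
      · have := (hu₁ ⟨v, hv⟩).2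
        rwa [hWu] at this
      · rw [hWu]
        exact hx
    · exact ⟨∅, fun h ↦ absurd h hv⟩
  have h2 (v : HeightOneSpectrum (𝓞 k)) : ∃ W : Set (Fin n → v.adicCompletion k),
      ∀ hv : Sum.inr v ∉ S, IsOpen W ∧ W.Nonempty ∧ ∀ x : Points X (v.adicCompletion k),
        coord j x ∈ W → (⟨v, hv⟩ ∈ J → x ∈ u₂ ⟨v, hv⟩) ∧
          (a.2 ⟨v, hv⟩ ∈ M.integralPoints v → x ∈ M.integralPoints v) := by
    by_cases hv : Sum.inr v ∉ S
    · let N₁ : Set (Points X (v.adicCompletion k)) := if ⟨v, hv⟩ ∈ J then u₂ ⟨v, hv⟩ else Set.univ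
      let N₂ : Set (Points X (v.adicCompletion k)) :=
        -- At places of the exceptional set, integrality is not automatic; where `a` is integral it
        -- is imposed as an open condition.
        if a.2 ⟨v, hv⟩ ∈ M.integralPoints v then M.integralPoints v else Set.univ
      have hN₁ : IsOpen N₁ ∧ a.2 ⟨v, hv⟩ ∈ N₁ := by
        by_cases h : ⟨v, hv⟩ ∈ J
        · simp only [N₁, if_pos h]
          exact hu₂ _ h
        · simp [N₁, if_neg h]
      have hN₂ : IsOpen N₂ ∧ a.2 ⟨v, hv⟩ ∈ N₂ := by
        by_cases h : a.2 ⟨v, hv⟩ ∈ M.integralPoints v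
        · simp only [N₂, if_pos h]
          exact ⟨M.isOpen_integralPoints v, h⟩
        · simp [N₂, if_neg h]
      obtain ⟨W, hW, hWu⟩ := exists_isOpen_coord j hj (hN₁.1.inter hN₂.1)
      refine ⟨W, fun _ ↦ ⟨hW, ⟨coord j (a.2 ⟨v, hv⟩), ?_⟩, fun x hx ↦ ?_⟩⟩
      · have : a.2 ⟨v, hv⟩ ∈ N₁ ∩ N₂ := ⟨hN₁.2, hN₂.2⟩
        rwa [hWu] at this
      · have hx' : x ∈ N₁ ∩ N₂ := by
          rw [hWu]
          exact hx
        refine ⟨fun h ↦ ?_, fun h ↦ ?_⟩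
        · have := hx'.1
          simpa only [N₁, if_pos h] using this
        · have := hx'.2
          simpa only [N₂, if_pos h] using this
    · exact ⟨∅, fun h ↦ absurd h hv⟩
  choose W hW using h1
  choose W' hW' using h2
  -- the finite set of places outside of which integrality is automatic
  obtain ⟨B, hB⟩ := hfg
  obtain ⟨Bf, hBf⟩ := M.exists_finset_mem_integralPoints j hj f hf
  obtain ⟨Bg, hBg⟩ := M.exists_finset_mem_integralPoints j hj g hg
  obtain ⟨y, hy, hy', hyT, hy0⟩ := hB (B ∪ Bf ∪ Bg ∪ J.image Subtype.val)
    (fun v hv ↦ by simp [hv]) W W' (fun v hv ↦ ⟨(hW v hv).1, (hW v hv).2.1⟩)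
    (fun v _ hv ↦ ⟨(hW' v hv).1, (hW' v hv).2.1⟩)
  obtain ⟨x, hx⟩ : ∃ x : Points X k, coord j x = y := by
    rcases hy0 with h | h
    · exact exists_point j hj f hf y h
    · exact exists_point j hj g hg y h
  have hcoord (F : Type u) [CommRing F] [Algebra k F] :
      coord j (x.baseChange F) = fun i ↦ algebraMap k F (y i) := by
    rw [coord_baseChange j hj, hx]
  obtain ⟨c, hc, hcx⟩ := hsub₂ (fun v ↦ x.baseChange (v.1.adicCompletion k))
    (fun v hv ↦ by
      refine ((hW' v.1 v.2).2.2 _ ?_).1 hv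
      rw [hcoord]
      exact hy' v.1 (Finset.mem_union_right _ (Finset.mem_image_of_mem _ hv)) v.2)
    (fun v hv ↦ by
      by_cases hvT : v.1 ∈ B ∪ Bf ∪ Bg ∪ J.image Subtype.val
      · refine ((hW' v.1 v.2).2.2 _ ?_).2 hv
        rw [hcoord]
        exact hy' v.1 hvT v.2
      · obtain ⟨hint, hfg⟩ := hyT v.1 hvT v.2
        simp only [Finset.mem_union, not_or] at hvT
        have hint' (i : Fin n) :
            Valued.v (coord j (x.baseChange (v.1.adicCompletion k)) i) ≤ 1 := by
          rw [hcoord, valued_algebraMap]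
          exact hint i
        rcases hfg with h | h
        · refine hBf v.1 hvT.1.1.2 _ hint' ?_
          rwa [hcoord, eval_algebraMap_comp, valued_algebraMap]
        · refine hBg v.1 hvT.1.2 _ hint' ?_
          rwa [hcoord, eval_algebraMap_comp, valued_algebraMap])
  refine ⟨(fun v ↦ x.baseChange v.1.Completion, c), hsub ⟨hsub₁ fun v _ ↦ ?_, hc⟩, x,
    fun v ↦ rfl, hcx⟩
  refine (hW v.1 v.2).2.2 _ ?_
  rw [hcoord]
  exact hy v.1 v.2

end Main

/-! ### Codimension and chains of primes -/

section Codim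

open TopologicalSpace

/-- A chain of two steps upwards from the closure of `Q` is a chain of primes descending from `Q`.
Its middle term strictly contains the last one and so is nonzero. -/
lemma exists_prime_lt_of_two_le_codim {R : Type u} [CommRing R] {Z : Set (PrimeSpectrum R)}
    (hZ : 2 ≤ codim Z) (hZc : IsClosed Z) (Q : PrimeSpectrum R) (hQ : Q ∈ Z) :
    ∃ P : Ideal R, P.IsPrime ∧ P ≠ ⊥ ∧ P < Q.asIdeal := by
  let e := PrimeSpectrum.pointsEquivIrreducibleCloseds R
  have h1 : ((OrderDual.ofDual (e Q) : IrreducibleCloseds (PrimeSpectrum R)) : Set _) ⊆ Z :=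
    hZc.closure_subset_iff.mpr (Set.singleton_subset_iff.mpr hQ)
  have h2 : ((2 : ℕ) : ℕ∞) ≤ Order.coheight (OrderDual.ofDual (e Q)) :=
    hZ.trans (iInf₂_le (OrderDual.ofDual (e Q)) (by exact h1))
  obtain ⟨p, hp, hlen⟩ := Order.exists_series_of_le_coheight _ h2
  have h01 : p ⟨0, by omega⟩ < p ⟨1, by omega⟩ := p.strictMono (Fin.mk_lt_mk.mpr Nat.one_pos)
  have h12 : p ⟨1, by omega⟩ < p ⟨2, by omega⟩ := p.strictMono (Fin.mk_lt_mk.mpr Nat.one_lt_two)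
  have hQP : e.symm (OrderDual.toDual (p ⟨1, by omega⟩)) < Q := by
    rw [e.symm_apply_lt, ← OrderDual.toDual_ofDual (e Q), ← hp]
    exact h01
  refine ⟨(e.symm (OrderDual.toDual (p ⟨1, by omega⟩))).asIdeal, PrimeSpectrum.isPrime _, ?_, hQP⟩
  have h3 : e.symm (OrderDual.toDual (p ⟨2, by omega⟩)) <
      e.symm (OrderDual.toDual (p ⟨1, by omega⟩)) := e.symm.strictMono h12
  intro h0
  have h4 : (e.symm (OrderDual.toDual (p ⟨2, by omega⟩))).asIdeal <
      (e.symm (OrderDual.toDual (p ⟨1, by omega⟩))).asIdeal := h3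
  rw [h0] at h4
  exact not_lt_bot h4

/-- A homeomorphism induces an order isomorphism on irreducible closed subsets. -/
def irreducibleClosedsCongr {T T' : Type*} [TopologicalSpace T] [TopologicalSpace T']
    (h : T ≃ₜ T') : IrreducibleCloseds T ≃o IrreducibleCloseds T' where
  toFun Y := ⟨h '' Y, Y.isIrreducible.image h h.continuous.continuousOn,
    h.isClosedMap _ Y.isClosed⟩
  invFun Y := ⟨h.symm '' Y, Y.isIrreducible.image h.symm h.symm.continuous.continuousOn,
    h.symm.isClosedMap _ Y.isClosed⟩
  left_inv Y := IrreducibleCloseds.ext (by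
    change h.symm '' (h '' Y) = Y
    simp [Set.image_image])
  right_inv Y := IrreducibleCloseds.ext (by
    change h '' (h.symm '' Y) = Y
    simp [Set.image_image])
  map_rel_iff' := Set.image_subset_image_iff h.injective

lemma codim_le_codim_image {T T' : Type u} [TopologicalSpace T] [TopologicalSpace T']
    (h : T ≃ₜ T') (Z : Set T) : codim Z ≤ codim (h '' Z) := by
  refine le_iInf₂ fun Y hY ↦ ?_
  rw [← Order.coheight_orderIso (irreducibleClosedsCongr h).symm Y]
  refine iInf₂_le _ ?_
  change h.symm '' Y ⊆ Z
  rw [h.symm.image_eq_preimage_symm]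
  intro z hz
  obtain ⟨w, hw, he⟩ := hY hz
  exact (h.injective he) ▸ hw

end Codim

/-! ### Complements of codimension at least two -/

section Main

open MvPolynomial

variable {k : Type u} [Field k] [NumberField k] {n : ℕ} {X : Over (Spec (.of k))}

/-- Strong approximation for open subschemes of affine spaces whose complement has codimension at
least two. -/
theorem strongApproximationOff_of_two_le_codim
    (j : X.left ⟶ Spec (.of (MvPolynomial (Fin n) k))) [IsOpenImmersion j]
    (hj : j ≫ Spec.map (CommRingCat.ofHom (algebraMap k _)) = X.hom)
    (S : Finset (Place k)) (hS : S.Nonempty)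
    (hcodim : 2 ≤ codim (Set.range j)ᶜ) : StrongApproximationOff X S := by
  let Z : Set (PrimeSpectrum (MvPolynomial (Fin n) k)) := (Set.range j)ᶜ
  have hZc : IsClosed Z := j.isOpenEmbedding.isOpen_range.isClosed_compl
  have hht := exists_prime_lt_of_two_le_codim hcodim hZc
  let I := PrimeSpectrum.vanishingIdeal Z
  have hI (f : MvPolynomial (Fin n) k) (hf : f ∈ I) :
      (PrimeSpectrum.basicOpen f : Set (PrimeSpectrum (MvPolynomial (Fin n) k))) ⊆
        Set.range j := by
    intro p hp
    by_contra hpZ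
    exact hp ((PrimeSpectrum.mem_vanishingIdeal _ _).mp hf p hpZ)
  cases n with
  | zero =>
    -- In dimension zero the coordinate ring is a field and has no nonzero prime, so the complement
    -- is empty.
    have huniv : Set.univ ⊆ Set.range j := by
      intro Q _
      by_contra hQ
      obtain ⟨P, hP, hP0, -⟩ := hht Q hQ
      obtain ⟨p, hpP, hp0⟩ := Submodule.exists_mem_ne_zero_of_ne_bot hP0
      refine hP.ne_top (Ideal.eq_top_of_isUnit_mem _ hpP ?_)
      rw [eq_C_of_isEmpty p] at hp0 ⊢
      exact (IsUnit.mk0 _ fun h ↦ hp0 (by rw [h, C_0])).map C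
    exact strongApproximationOff_of_approximablePair j hj S 1 1
      ((Set.subset_univ _).trans huniv) ((Set.subset_univ _).trans huniv)
      (approximablePair_zero S hS)
  | succ m =>
    obtain ⟨σ, f, r, hf, hr, hfI, hrI⟩ := exists_monic_and_eliminant I fun Q hQ hIQ ↦ by
      refine hht ⟨Q, hQ⟩ ?_
      have : (⟨Q, hQ⟩ : PrimeSpectrum _) ∈ PrimeSpectrum.zeroLocus (I : Set _) := hIQ
      rwa [PrimeSpectrum.zeroLocus_vanishingIdeal_eq_closure, hZc.closure_eq] at this
    -- The change of coordinates is absorbed into the open immersion, leaving `X` itself unchanged.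
    let ε := σ.symm.toRingEquiv.toCommRingCatIso
    have hbasic (g : MvPolynomial (Fin (m + 1)) k) (hg : σ.symm g ∈ I) :
        (PrimeSpectrum.basicOpen g : Set (PrimeSpectrum (MvPolynomial (Fin (m + 1)) k))) ⊆
          Set.range (j ≫ Spec.map ε.hom) := by
      intro p hp
      obtain ⟨x, hx⟩ := hI _ hg (show PrimeSpectrum.comap σ.toAlgHom.toRingHom p ∈ _ from
        fun h ↦ hp (by simpa [PrimeSpectrum.comap_asIdeal, Ideal.mem_comap] using! h))
      refine ⟨x, ?_⟩
      rw [Scheme.Hom.comp_apply, hx]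
      refine PrimeSpectrum.ext (Ideal.ext fun a ↦ ?_)
      change σ (σ.symm a) ∈ p.asIdeal ↔ _
      rw [σ.apply_symm_apply]
    refine strongApproximationOff_of_approximablePair (j ≫ Spec.map ε.hom) ?_ S f
      (rename Fin.succ r) (hbasic _ hfI) (hbasic _ hrI) (approximablePair_of_monic S hS f r hf hr)
    rw [Category.assoc, ← Spec.map_comp, ← hj]
    congr 2
    exact CommRingCat.hom_ext (RingHom.ext fun a ↦ σ.symm.commutes a)

/-- Strong approximation for open subschemes of a scheme isomorphic to affine space. -/
theorem strongApproximationOff_of_iso {Y : Scheme.{u}} (p : Y ⟶ Spec (.of k))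
    (e : Y ≅ Spec (.of (MvPolynomial (Fin n) k)))
    (he : e.hom ≫ Spec.map (CommRingCat.ofHom (algebraMap k _)) = p) (U : Y.Opens)
    (S : Finset (Place k)) (hS : S.Nonempty) (hcodim : 2 ≤ codim (U : Set Y)ᶜ) :
    StrongApproximationOff (Over.mk (U.ι ≫ p)) S := by
  refine strongApproximationOff_of_two_le_codim (X := Over.mk (U.ι ≫ p)) (U.ι ≫ e.hom) ?_ S hS ?_
  · rw [Category.assoc, he]
    rfl
  · refine hcodim.trans ((codim_le_codim_image (Scheme.homeoOfIso e) _).trans_eq ?_)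
    rw [Set.image_compl_eq (Scheme.homeoOfIso e).bijective]
    congr 2
    ext z
    refine ⟨?_, ?_⟩
    · rintro ⟨q, hq, rfl⟩
      exact ⟨⟨q, hq⟩, Scheme.Hom.comp_apply _ _ _⟩
    · rintro ⟨q, rfl⟩
      exact ⟨U.ι q, q.2, (Scheme.Hom.comp_apply _ _ _).symm⟩

end Main

end StrongApprox

end

theorem mainTheorem11 (k : Type u) [Field k] [NumberField k]
    (S : Finset (StrongApprox.Place k)) (hS : S.Nonempty) :
    (∀ (n : ℕ) (U : (AffineSpace (ULift.{u} (Fin n)) (Spec (.of k))).Opens),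
      2 ≤ StrongApprox.codim (U : Set (AffineSpace (ULift.{u} (Fin n)) (Spec (.of k))))ᶜ →
        StrongApprox.StrongApproximationOff (StrongApprox.openInAffineSpace U) S) ∧
    (∀ (d : ℕ) (_ : 0 < d) (L : Fin d → Type u) [∀ i, Field (L i)] [∀ i, Algebra k (L i)]
      [∀ i, FiniteDimensional k (L i)] (X : (StrongApprox.ResA1 k (∀ i, L i)).Opens),
      StrongApprox.IsStandardToricVariety X →
        StrongApprox.StrongApproximationOff (StrongApprox.openInResA1 X) S) := by
  refine ⟨fun n U hU ↦ ?_, fun d _ L _ _ _ X hX ↦ ?_⟩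
  · let ε := (MvPolynomial.renameEquiv k
      (Equiv.ulift.{u} : ULift.{u} (Fin n) ≃ Fin n).symm).toRingEquiv.toCommRingCatIso
    refine StrongApprox.strongApproximationOff_of_iso _
      (AffineSpace.SpecIso (ULift.{u} (Fin n)) (.of k) ≪≫ Scheme.Spec.mapIso ε.op) ?_ U S hS hU
    rw [← cancel_epi (AffineSpace.SpecIso (ULift.{u} (Fin n)) (.of k)).inv,
      AffineSpace.SpecIso_inv_over, Iso.trans_hom, Category.assoc, Iso.inv_hom_id_assoc]
    change Spec.map ε.hom ≫ _ = _
    rw [← Spec.map_comp]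
    congr 1
    exact CommRingCat.hom_ext (RingHom.ext fun a ↦ (MvPolynomial.renameEquiv k
      (Equiv.ulift.{u} : ULift.{u} (Fin n) ≃ Fin n).symm).commutes a)
  -- A basis of the dual of `K` identifies the Weil restriction with affine space.
  · let φ := (SymmetricAlgebra.equivMvPolynomial
      (Module.finBasis k (Module.Dual k (∀ i, L i)))).symm
    let ε := φ.toRingEquiv.toCommRingCatIso
    refine StrongApprox.strongApproximationOff_of_iso _ (Scheme.Spec.mapIso ε.op) ?_ X S hS
      hX.two_le_codim
    change Spec.map ε.hom ≫ _ = _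
    rw [← Spec.map_comp]
    congr 1
    exact CommRingCat.hom_ext (RingHom.ext fun a ↦ φ.commutes a)
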